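/- Logarithms are to base $2$. For $n\ge 0$ consider the algebra $\mathcal B((\mathbb C^2)^{\otimes n})$ of $n$ qubits, i.e. $n$ uses of the noiseless qubit channel $\mathrm{id}_{\mathbb C^2}$. An $(n,\lambda_1,\lambda_2)$-identification (ID) code with $N$ messages is a family $(\rho_i,D_i)_{i=1}^N$ of (possibly mixed) states $\rho_i$ and operators $0\le D_i\le \mathbb 1$ on $n$ qubits with $\operatorname{Tr}(\rho_iD_i)\ge 1-\lambda_1$ for all $i$ and $\operatorname{Tr}(\rho_iD_j)\le\lambda_2$ for all $i\ne j$; $N(n,\lambda_1,\lambda_2)$ is the maximal number of messages of such a code. An $(n,\lambda)$-transmission code with $M$ messages is a family $(\rho_i,D_i)_{i=1}^M$ of states $\rho_i$ and operators $D_i\ge 0$ with $\sum_i D_i=\mathbb 1$ and $\operatorname{Tr}(\rho_iD_i)\ge 1-\lambda$ for all $i$; $M(n,\lambda)$ is the maximal number of messages of such a code. A common randomness protocol of block length $n$ consists of a finite-valued local random variable $u$ of the sender, states $\rho_u$ on $n$ qubits, which the sender transmits, a POVM $(E_v)_v$ with finitely many outcomes measured by the receiver, and functions $K=K(u)$, $L=L(v)$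 with values in a common finite set $\mathcal K$. A rate $R$ is achievable if there is a constant $c$ such that for every $\varepsilon>0$ and all sufficiently large $n$ there is a protocol with $|\mathcal K|\le 2^{cn}$, $\Pr\{K\ne L\}\le\varepsilon$ and $\frac1nH(K)\ge R-\varepsilon$ ($H$ is the Shannon entropy). The common randomness capacity $\mathrm{CR}(\mathrm{id}_{\mathbb C^2})$ is the supremum of the achievable rates. **Theorem.** For all $\lambda_1,\lambda_2>0$ with $\lambda_1+\lambda_2<1$ the maxima $N(n,\lambda_1,\lambda_2)$ exist and $$\lim_{n\to\infty}\frac1n\log\log N(n,\lambda_1,\lambda_2)=2 .$$ In particular the identification capacity $$C_{\mathrm{ID}}(\mathrm{id}_{\mathbb C^2})=\inf_{\lambda_1,\lambda_2>0,\ \lambda_1+\lambda_2<1}\ \liminf_{n\to\infty}\frac1n\log\log N(n,\lambda_1,\lambda_2)$$ equals $2$, with the strong converse. For $0<\lambda<1$ the maxima $M(n,\lambda)$ exist, and the transmission capacity is $$C(\mathrm{id}_{\mathbb C^2})=\inf_{0<\lambda<1}\liminf_{n\to\infty}\frac1n\log M(n,\lambda)=\inf_{0<\lambda<1}\limsup_{n\to\infty}\frac1n\log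 M(n,\lambda)=1 .$$ Moreover $\mathrm{CR}(\mathrm{id}_{\mathbb C^2})=1$. Hence $C_{\mathrm{ID}}(\mathrm{id}_{\mathbb C^2})=2\,C(\mathrm{id}_{\mathbb C^2})=2\,\mathrm{CR}(\mathrm{id}_{\mathbb C^2})$. -/

import Mathlib

open Matrix Filter Topology
open scoped BigOperators ComplexOrder

noncomputable section

namespace QuantumID

/-- Completely positive trace preserving maps `B(ℂ^α) → B(ℂ^β)` (Schrödinger picture). -/
structure Channel (α β : Type) [Fintype α] [DecidableEq α] [Fintype β] [DecidableEq β] where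
  toLin : Matrix α α ℂ →ₗ[ℂ] Matrix β β ℂ
  /-- For every `k`, the ampliation `T ⊗ id_k` preserves positive semidefiniteness. -/
  completelyPositive : ∀ (k : ℕ) (X : Matrix (α × Fin k) (α × Fin k) ℂ), X.PosSemidef →
    (Matrix.of fun p q : β × Fin k =>
      toLin (Matrix.of fun a a' => X (a, p.2) (a', q.2)) p.1 q.1).PosSemidef
  tracePreserving : ∀ X : Matrix α α ℂ, (toLin X).trace = X.trace

/-- The ideal (noiseless) channel on `B(ℂ^α)`. -/
def idChannel (α : Type) [Fintype α] [DecidableEq α] : Channel α α where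
  toLin := LinearMap.id
  completelyPositive := fun _ _ hX => hX
  tracePreserving := fun _ => rfl

/-- The noiseless qubit channel. -/
abbrev idQubit : Channel (Fin 2) (Fin 2) := idChannel (Fin 2)

section Codes

variable {α β : Type} [Fintype α] [DecidableEq α] [Fintype β] [DecidableEq β]

/-- The `n`-fold tensor power `T^{⊗n}` of a channel. Here `(ℂ^α)^{⊗n}` has the product basis
indexed by `Fin n → α`, the matrix unit `|a⟩⟨a'|` is the tensor product of the
`|a k⟩⟨a' k|`, and it is sent to the tensor product of the `T (|a k⟩⟨a' k|)`. -/
def tensorPower (T : Channel α β) (n : ℕ) :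
    Matrix (Fin n → α) (Fin n → α) ℂ →ₗ[ℂ] Matrix (Fin n → β) (Fin n → β) ℂ where
  toFun X := Matrix.of fun b b' =>
    ∑ a : Fin n → α, ∑ a' : Fin n → α,
      X a a' * ∏ k : Fin n, T.toLin (Matrix.single (a k) (a' k) 1) (b k) (b' k)
  map_add' X Y := by
    ext b b'
    simp [add_mul, Finset.sum_add_distrib]
  map_smul' c X := by
    ext b b'
    simp [mul_assoc, Finset.mul_sum]

/-- Density matrices. -/
def IsState (ρ : Matrix α α ℂ) : Prop := ρ.PosSemidef ∧ ρ.trace = 1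

/-- Effects: operators `D` with `0 ≤ D ≤ 1`. -/
def IsEffect (D : Matrix α α ℂ) : Prop := D.PosSemidef ∧ (1 - D).PosSemidef

/-- Positive operator valued measures with finitely many outcomes. -/
def IsPOVM {ι : Type} [Fintype ι] (D : ι → Matrix α α ℂ) : Prop :=
  (∀ i, (D i).PosSemidef) ∧ ∑ i, D i = 1

/-- `Tr (T^{⊗n}(ρ) D)`, the probability that the effect `D` responds to the output of the
`n`-block channel on input `ρ`. -/
def prob (T : Channel α β) (n : ℕ) (ρ : Matrix (Fin n → α) (Fin n → α) ℂ)
    (D : Matrix (Fin n → β) (Fin n → β) ℂ) : ℝ :=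
  ((tensorPower T n ρ * D).trace).re

/-- `(n, l₁, l₂)`-ID codes with `N` messages. -/
structure IsIDCode (T : Channel α β) (n : ℕ) (l₁ l₂ : ℝ) (N : ℕ)
    (ρ : Fin N → Matrix (Fin n → α) (Fin n → α) ℂ)
    (D : Fin N → Matrix (Fin n → β) (Fin n → β) ℂ) : Prop where
  state : ∀ i, IsState (ρ i)
  effect : ∀ i, IsEffect (D i)
  first_kind : ∀ i, 1 - l₁ ≤ prob T n (ρ i) (D i)
  second_kind : ∀ i j, i ≠ j → prob T n (ρ i) (D j) ≤ l₂

/-- The numbers of messages of the `(n, l₁, l₂)`-ID codes for `T`. -/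
def idCodeSizes (T : Channel α β) (n : ℕ) (l₁ l₂ : ℝ) : Set ℕ :=
  {N | ∃ ρ D, IsIDCode T n l₁ l₂ N ρ D}

/-- `N(n, l₁, l₂)`, the maximal number of messages of an `(n, l₁, l₂)`-ID code (meaningful for
`l₁ + l₂ < 1`; otherwise there may be no maximum). -/
def maxID (T : Channel α β) (n : ℕ) (l₁ l₂ : ℝ) : ℕ := sSup (idCodeSizes T n l₁ l₂)

/-- The rate `(1/n) log log N(n, l₁, l₂)`, logarithms to base 2. -/
def idRate (T : Channel α β) (l₁ l₂ : ℝ) (n : ℕ) : ℝ :=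
  1 / (n : ℝ) * Real.logb 2 (Real.logb 2 (maxID T n l₁ l₂ : ℝ))

/-- The identification capacity `C_ID(T)`: the infimum over the error probabilities of
`liminf (1/n) log log N(n, l₁, l₂)`. As `N` is monotone in `l₁` and `l₂`, only small error
probabilities matter. -/
def idCapacity (T : Channel α β) : EReal :=
  ⨅ (l₁ : ℝ) (l₂ : ℝ) (_ : 0 < l₁ ∧ 0 < l₂ ∧ l₁ + l₂ < 1),
    liminf (fun n : ℕ => (idRate T l₁ l₂ n : EReal)) atTop

/-- `(n, l)`-transmission codes with `M` messages. -/
structure IsCode (T : Channel α β) (n : ℕ) (l : ℝ) (M : ℕ)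
    (ρ : Fin M → Matrix (Fin n → α) (Fin n → α) ℂ)
    (D : Fin M → Matrix (Fin n → β) (Fin n → β) ℂ) : Prop where
  state : ∀ i, IsState (ρ i)
  povm : IsPOVM D
  error : ∀ i, 1 - l ≤ prob T n (ρ i) (D i)

/-- The numbers of messages of the `(n, l)`-codes for `T`. -/
def codeSizes (T : Channel α β) (n : ℕ) (l : ℝ) : Set ℕ :=
  {M | ∃ ρ D, IsCode T n l M ρ D}

/-- `M(n, l)`, the maximal number of messages of an `(n, l)`-code (meaningful for `l < 1`). -/
def maxCode (T : Channel α β) (n : ℕ) (l : ℝ) : ℕ := sSup (codeSizes T n l)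

/-- The rate `(1/n) log M(n, l)`, logarithm to base 2. -/
def codeRate (T : Channel α β) (l : ℝ) (n : ℕ) : ℝ :=
  1 / (n : ℝ) * Real.logb 2 (maxCode T n l : ℝ)

/-- The (pessimistic) transmission capacity `C(T) = inf_l liminf (1/n) log M(n, l)`. -/
def transmissionCapacity (T : Channel α β) : EReal :=
  ⨅ (l : ℝ) (_ : 0 < l ∧ l < 1), liminf (fun n : ℕ => (codeRate T l n : EReal)) atTop

/-- The optimistic transmission capacity `inf_l limsup (1/n) log M(n, l)`. -/
def transmissionCapacityUpper (T : Channel α β) : EReal :=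
  ⨅ (l : ℝ) (_ : 0 < l ∧ l < 1), limsup (fun n : ℕ => (codeRate T l n : EReal)) atTop

/-- A protocol of block length `n` that generates common randomness with values in `Fin s`.
The sender draws a local random variable `u`, keeps `K = key u` and sends the state `state u`.
The receiver measures a POVM on the output of the channel (his local randomness is absorbed in
the POVM) and from the outcome `v` computes `L = out v`. -/
structure CRProtocol (T : Channel α β) (n s : ℕ) where
  U : ℕ
  law : Fin U → ℝ
  law_nonneg : ∀ u, 0 ≤ law u
  law_sum : ∑ u, law u = 1
  state : Fin U → Matrix (Fin n → α) (Fin n → α) ℂ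
  isState : ∀ u, IsState (state u)
  key : Fin U → Fin s
  V : ℕ
  povm : Fin V → Matrix (Fin n → β) (Fin n → β) ℂ
  isPOVM : IsPOVM povm
  out : Fin V → Fin s

namespace CRProtocol

/-- The probability that `K = L`. -/
def agreement {T : Channel α β} {n s : ℕ} (P : CRProtocol T n s) : ℝ :=
  ∑ u, ∑ v, if P.key u = P.out v then P.law u * prob T n (P.state u) (P.povm v) else 0

/-- The distribution of `K`. -/
def keyLaw {T : Channel α β} {n s : ℕ} (P : CRProtocol T n s) (k : Fin s) : ℝ :=
  ∑ u, if P.key u = k then P.law u else 0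

/-- The Shannon entropy `H(K)` in bits. -/
def keyEntropy {T : Channel α β} {n s : ℕ} (P : CRProtocol T n s) : ℝ :=
  -∑ k, P.keyLaw k * Real.logb 2 (P.keyLaw k)

end CRProtocol

/-- `R` is an achievable common randomness rate: for some constant `c`, every `ε > 0` and all
sufficiently large `n` there is a protocol of block length `n` whose `K` takes at most
`2 ^ (c n)` values, with `Pr {K ≠ L} ≤ ε` and `H(K) / n ≥ R - ε`. -/
def IsAchievableCRRate (T : Channel α β) (R : ℝ) : Prop :=
  ∃ c : ℝ, ∀ ε : ℝ, 0 < ε → ∀ᶠ n : ℕ in atTop,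
    ∃ (s : ℕ) (P : CRProtocol T n s), (s : ℝ) ≤ (2 : ℝ) ^ (c * (n : ℝ)) ∧
      1 - ε ≤ P.agreement ∧ R - ε ≤ 1 / (n : ℝ) * P.keyEntropy

/-- The common randomness capacity: the supremum of the achievable rates. -/
def crCapacity (T : Channel α β) : EReal :=
  ⨆ (R : ℝ) (_ : IsAchievableCRRate T R), (R : EReal)

end Codes

end QuantumID

end

/-!
# Capacities of the noiseless qubit channel

Put `d = 2 ^ n`. The output of the noiseless channel is its input, so an error probability is
`Tr (ρ D)` for `d × d` matrices (`prob_idChannel`).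

**ID codes, lower bound.** A message is encoded as the uniform mixture `ρ` of `r` random vectors
with entries `± 1 / √d`, and `D` is the orthogonal projector onto their span, so that
`Tr (ρ D) = 1`. For a fixed projector `D` of rank at most `r` the mean of `Tr (ρ D)` over an
independent `ρ` is at most `r / d`. What matters is that its tail beyond a constant has size
`exp (-c r d)`, as the squared length of the projection of a vector of `d` signs has a bounded
exponential moment per dimension (`sum_exp_norm_sq_projection_le`, `card_large_projection_le`).
With `r` a small multiple of `d`, two independent codewords therefore conflict with probability
`exp (-c d ^ 2)`. The conflicts form a directed graph with small out-degrees, in which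
`exists_independent_finset` finds `exp (c d ^ 2)` messages without conflicts
(`exists_states_effects`). Hence `log log N ≥ 2 n - O(1)`.

**ID codes, upper bound.** The states of different messages differ by a constant in the
expectation of an effect. They are thus separated by a grid of mesh of order `d ^ (-2)` on the
entries, which has `(O(1) d ^ 2) ^ (2 d ^ 2)` cells (`IsIDCode.card_le`), so
`log log N ≤ 2 n + O(log n)`. This holds for all error probabilities with sum below one, whence
the strong converse.

**Transmission.** From `Tr (ρ D) ≤ Tr D` and `∑ Tr (D i) = d` follows `M (1 - l) ≤ d`
(`IsCode.card_mul_le`), and the product basis is a code with `d` messages.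

**Common randomness.** Whatever is sent, the receiver outputs `k` with probability at most
`t k`, where `∑ t k ≤ d`. A key guessed correctly with probability `1 - ε` in this way has
entropy at most `n + 2 + 2 ε (1 + log s)` (`entropy_le_of_guessing`), and `log s = O(n)`. A
uniformly random element of the product basis attains `n` bits.
-/

namespace QuantumID

/-! ### Positive semidefinite matrices, states and effects -/

section PositiveMatrices

variable {α : Type}

theorem diag_re_nonneg {A : Matrix α α ℂ} (hA : A.PosSemidef) (a : α) : 0 ≤ (A a a).re :=
  (Complex.le_def.mp (hA.diag_nonneg (i := a))).1

variable [Fintype α]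

theorem trace_re (A : Matrix α α ℂ) : A.trace.re = ∑ a, (A a a).re := by
  simp [Matrix.trace]

theorem IsState.trace_re_eq_one {ρ : Matrix α α ℂ} (h : IsState ρ) : ρ.trace.re = 1 := by
  rw [h.2, Complex.one_re]

variable [DecidableEq α]

open scoped MatrixOrder Matrix.Norms.L2Operator in
theorem exists_eq_conjTranspose_mul_self {A : Matrix α α ℂ} (hA : A.PosSemidef) :
    ∃ B : Matrix α α ℂ, A = Bᴴ * B :=
  CStarAlgebra.nonneg_iff_eq_star_mul_self.mp (Matrix.nonneg_iff_posSemidef.mpr hA)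

theorem norm_entry_sq_le {A : Matrix α α ℂ} (hA : A.PosSemidef) (a b : α) :
    ‖A a b‖ ^ 2 ≤ (A a a).re * (A b b).re := by
  obtain ⟨B, rfl⟩ := exists_eq_conjTranspose_mul_self hA
  have hdiag : ∀ a, ((Bᴴ * B) a a).re = ∑ c, ‖B c a‖ ^ 2 := by
    intro a
    rw [Matrix.mul_apply, Complex.re_sum]
    refine Finset.sum_congr rfl fun c _ => ?_
    rw [conjTranspose_apply, Complex.star_def, ← Complex.normSq_eq_conj_mul_self,
      Complex.ofReal_re, Complex.normSq_eq_norm_sq]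
  rw [hdiag, hdiag]
  refine le_trans ?_ (Finset.sum_mul_sq_le_sq_mul_sq _ _ _)
  gcongr
  rw [Matrix.mul_apply]
  refine (norm_sum_le _ _).trans (le_of_eq ?_)
  simp

theorem norm_entry_le_sqrt {A : Matrix α α ℂ} (hA : A.PosSemidef) (a b : α) :
    ‖A a b‖ ≤ √(A a a).re * √(A b b).re := by
  rw [← Real.sqrt_mul (diag_re_nonneg hA a)]
  exact Real.le_sqrt_of_sq_le (norm_entry_sq_le hA a b)

theorem norm_entry_le_of_diag_le {A : Matrix α α ℂ} (hA : A.PosSemidef)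
    (h : ∀ a, (A a a).re ≤ 1) (a b : α) : ‖A a b‖ ≤ 1 :=
  (norm_entry_le_sqrt hA a b).trans <|
    mul_le_one₀ (Real.sqrt_le_one.mpr (h a)) (Real.sqrt_nonneg _) (Real.sqrt_le_one.mpr (h b))

theorem trace_mul_re_nonneg {A B : Matrix α α ℂ} (hA : A.PosSemidef) (hB : B.PosSemidef) :
    0 ≤ (A * B).trace.re := by
  obtain ⟨C, rfl⟩ := exists_eq_conjTranspose_mul_self hA
  rw [Matrix.mul_assoc, Matrix.trace_mul_comm]
  exact (Complex.le_def.mp (hB.mul_mul_conjTranspose_same C).trace_nonneg).1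

/-- Entrywise, `|A a b| ≤ √(A a a) √(A b b)`, and the sum over `a` and `b` becomes a square. -/
theorem trace_mul_re_le {A B : Matrix α α ℂ} (hA : A.PosSemidef) (hB : B.PosSemidef) :
    (A * B).trace.re ≤ A.trace.re * B.trace.re := by
  have hA0 := diag_re_nonneg hA
  have hB0 := diag_re_nonneg hB
  calc (A * B).trace.re ≤ ‖(A * B).trace‖ := Complex.re_le_norm _
    _ ≤ ∑ a, ∑ b, ‖A a b‖ * ‖B b a‖ := by
        simp only [Matrix.trace, Matrix.diag, Matrix.mul_apply]
        refine (norm_sum_le _ _).trans (Finset.sum_le_sum fun a _ => ?_)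
        refine (norm_sum_le _ _).trans (Finset.sum_le_sum fun b _ => ?_)
        rw [norm_mul]
    _ ≤ ∑ a, ∑ b, (√(A a a).re * √(B a a).re) * (√(A b b).re * √(B b b).re) := by
        refine Finset.sum_le_sum fun a _ => Finset.sum_le_sum fun b _ => ?_
        calc ‖A a b‖ * ‖B b a‖
            ≤ (√(A a a).re * √(A b b).re) * (√(B b b).re * √(B a a).re) := by
              gcongr
              · exact norm_entry_le_sqrt hA a b
              · exact norm_entry_le_sqrt hB b a
          _ = _ := by ring
    _ = (∑ a, √(A a a).re * √(B a a).re) ^ 2 := by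
        rw [sq, Finset.sum_mul_sum]
    _ ≤ (∑ a, √(A a a).re ^ 2) * ∑ a, √(B a a).re ^ 2 :=
        Finset.sum_mul_sq_le_sq_mul_sq _ _ _
    _ = A.trace.re * B.trace.re := by
        simp only [trace_re, Real.sq_sqrt (hA0 _), Real.sq_sqrt (hB0 _)]

theorem IsState.norm_entry_le_one {ρ : Matrix α α ℂ} (h : IsState ρ) (a b : α) :
    ‖ρ a b‖ ≤ 1 := by
  refine norm_entry_le_of_diag_le h.1 (fun a => ?_) a b
  rw [← h.trace_re_eq_one, trace_re]
  exact Finset.single_le_sum (f := fun a => (ρ a a).re)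
    (fun a _ => diag_re_nonneg h.1 a) (Finset.mem_univ a)

theorem IsEffect.norm_entry_le_one {D : Matrix α α ℂ} (h : IsEffect D) (a b : α) :
    ‖D a b‖ ≤ 1 := by
  refine norm_entry_le_of_diag_le h.1 (fun a => ?_) a b
  simpa using diag_re_nonneg h.2 a

/-- A density matrix is at most the identity, so its expectation in an effect is at most the
trace of the effect. -/
theorem IsState.trace_mul_re_le {ρ D : Matrix α α ℂ} (h : IsState ρ) (hD : D.PosSemidef) :
    (ρ * D).trace.re ≤ D.trace.re := by
  simpa [h.trace_re_eq_one] using QuantumID.trace_mul_re_le h.1 hD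

end PositiveMatrices

/-! ### The noiseless channel -/

section IdentityChannel

variable {α : Type} [Fintype α] [DecidableEq α]

theorem tensorPower_idChannel (n : ℕ) (X : Matrix (Fin n → α) (Fin n → α) ℂ) :
    tensorPower (idChannel α) n X = X := by
  ext b b'
  have hprod : ∀ a a' : Fin n → α,
      (∏ k : Fin n, (Matrix.single (a k) (a' k) (1 : ℂ)) (b k) (b' k)) =
        if a = b ∧ a' = b' then 1 else 0 := by
    intro a a'
    simp only [Matrix.single_apply]
    rw [Fintype.prod_ite_zero]
    simp [funext_iff, forall_and]
  change ∑ a : Fin n → α, ∑ a' : Fin n → α,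
    X a a' * ∏ k : Fin n, (Matrix.single (a k) (a' k) (1 : ℂ)) (b k) (b' k) = X b b'
  simp only [hprod, mul_ite, mul_one, mul_zero, ite_and]
  simp

theorem prob_idChannel (n : ℕ) (ρ D : Matrix (Fin n → α) (Fin n → α) ℂ) :
    prob (idChannel α) n ρ D = (ρ * D).trace.re := by
  rw [prob, tensorPower_idChannel]

end IdentityChannel

/-! ### Upper bound for ID codes -/

section IDConverse

variable {α : Type}

/-- The entries of a matrix rounded to the grid of mesh `1 / K`. -/
noncomputable def gridCell (K : ℕ) (ρ : Matrix α α ℂ) : α → α → ℤ × ℤ :=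
  fun a b => (⌊(K : ℝ) * (ρ a b).re⌋, ⌊(K : ℝ) * (ρ a b).im⌋)

theorem abs_sub_lt_of_floor_eq {K : ℕ} (hK : 0 < K) {x y : ℝ}
    (h : ⌊(K : ℝ) * x⌋ = ⌊(K : ℝ) * y⌋) : |x - y| < 1 / K := by
  have hK' : (0 : ℝ) < K := by exact_mod_cast hK
  rw [lt_div_iff₀ hK', ← abs_of_pos hK', ← abs_mul, sub_mul, mul_comm x, mul_comm y]
  exact Int.abs_sub_lt_one_of_floor_eq_floor (by simpa [abs_of_pos hK'] using h)

theorem norm_entry_sub_le_of_gridCell_eq {K : ℕ} (hK : 0 < K) {ρ σ : Matrix α α ℂ}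
    (h : gridCell K ρ = gridCell K σ) (a b : α) : ‖ρ a b - σ a b‖ ≤ 2 / K := by
  have hab := congrFun (congrFun h a) b
  simp only [gridCell, Prod.mk.injEq] at hab
  have h1 := abs_sub_lt_of_floor_eq hK hab.1
  have h2 := abs_sub_lt_of_floor_eq hK hab.2
  refine (Complex.norm_le_abs_re_add_abs_im _).trans ?_
  rw [Complex.sub_re, Complex.sub_im]
  have : (2 : ℝ) / K = 1 / K + 1 / K := by ring
  linarith

theorem floor_mul_mem_Icc {K : ℕ} {x : ℝ} (hx : |x| ≤ 1) :
    ⌊(K : ℝ) * x⌋ ∈ Finset.Icc (-(K : ℤ)) K := by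
  obtain ⟨h1, h2⟩ := abs_le.mp hx
  have hK : (0 : ℝ) ≤ K := K.cast_nonneg
  rw [Finset.mem_Icc, Int.le_floor]
  constructor
  · push_cast
    nlinarith
  · have : (⌊(K : ℝ) * x⌋ : ℝ) ≤ ((K : ℤ) : ℝ) := (Int.floor_le _).trans (by push_cast; nlinarith)
    exact_mod_cast this

variable [Fintype α]

theorem re_trace_mul_sub_le {ρ σ D : Matrix α α ℂ} {c : ℝ}
    (h : ∀ a b, ‖ρ a b - σ a b‖ ≤ c) (hD : ∀ a b, ‖D a b‖ ≤ 1) :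
    (ρ * D).trace.re - (σ * D).trace.re ≤ (Fintype.card α : ℝ) ^ 2 * c := by
  rw [← Complex.sub_re, ← Matrix.trace_sub, ← Matrix.sub_mul]
  refine (Complex.re_le_norm _).trans ?_
  simp only [Matrix.trace, Matrix.diag, Matrix.mul_apply, Matrix.sub_apply]
  calc ‖∑ a, ∑ b, (ρ a b - σ a b) * D b a‖ ≤ ∑ a, ∑ b, ‖(ρ a b - σ a b) * D b a‖ :=
        (norm_sum_le _ _).trans (Finset.sum_le_sum fun a _ => norm_sum_le _ _)
    _ ≤ ∑ _a : α, ∑ _b : α, c := by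
        refine Finset.sum_le_sum fun a _ => Finset.sum_le_sum fun b _ => ?_
        rw [norm_mul]
        calc ‖ρ a b - σ a b‖ * ‖D b a‖ ≤ ‖ρ a b - σ a b‖ * 1 := by gcongr; exact hD b a
          _ ≤ c := by rw [mul_one]; exact h a b
    _ = (Fintype.card α : ℝ) ^ 2 * c := by
        simp only [Finset.sum_const, Finset.card_univ, nsmul_eq_mul]
        ring

/-- Two messages of an ID code whose states lie in one cell of a fine grid could not be told
apart, so there are at most as many messages as cells. -/
theorem IsIDCode.card_le {α : Type} [Fintype α] [DecidableEq α] {n : ℕ} {l₁ l₂ : ℝ} {N : ℕ}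
    {ρ D : Fin N → Matrix (Fin n → α) (Fin n → α) ℂ}
    (h : IsIDCode (idChannel α) n l₁ l₂ N ρ D) {K : ℕ} (hK : 0 < K)
    (hKδ : 2 * ((Fintype.card α : ℝ) ^ n) ^ 2 < K * (1 - l₁ - l₂)) :
    N ≤ (2 * K + 1) ^ (2 * (Fintype.card α ^ n) ^ 2) := by
  classical
  let J := (Fin n → α) → (Fin n → α) →
    (Finset.Icc (-(K : ℤ)) K : Finset ℤ) × (Finset.Icc (-(K : ℤ)) K : Finset ℤ)
  let f : Fin N → J := fun i a b =>
    (⟨⌊(K : ℝ) * (ρ i a b).re⌋, floor_mul_mem_Icc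
        ((Complex.abs_re_le_norm _).trans ((h.state i).norm_entry_le_one a b))⟩,
      ⟨⌊(K : ℝ) * (ρ i a b).im⌋, floor_mul_mem_Icc
        ((Complex.abs_im_le_norm _).trans ((h.state i).norm_entry_le_one a b))⟩)
  have hf : Function.Injective f := by
    intro i j hij
    by_contra hne
    have hcell : gridCell K (ρ i) = gridCell K (ρ j) := by
      funext a b
      have := congrFun (congrFun hij a) b
      simp only [f, Prod.mk.injEq, Subtype.mk.injEq] at this
      exact Prod.ext this.1 this.2
    have hdiff := re_trace_mul_sub_le (norm_entry_sub_le_of_gridCell_eq hK hcell)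
      (h.effect i).norm_entry_le_one
    have h1 := h.first_kind i
    have h2 := h.second_kind j i (Ne.symm hne)
    rw [prob_idChannel] at h1 h2
    have hK' : (0 : ℝ) < K := by exact_mod_cast hK
    have hcard : (Fintype.card (Fin n → α) : ℝ) = (Fintype.card α : ℝ) ^ n := by simp
    rw [hcard, ← mul_div_assoc] at hdiff
    have : 1 - l₁ - l₂ ≤ (((Fintype.card α : ℝ) ^ n) ^ 2 * 2) / K := by linarith
    rw [le_div_iff₀ hK'] at this
    linarith
  have hle := Fintype.card_le_of_injective f hf
  have hI : (Finset.Icc (-(K : ℤ)) K).card = 2 * K + 1 := by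
    rw [Int.card_Icc]
    omega
  calc N = Fintype.card (Fin N) := (Fintype.card_fin N).symm
    _ ≤ Fintype.card J := hle
    _ = (2 * K + 1) ^ (2 * (Fintype.card α ^ n) ^ 2) := by
        simp only [J, Fintype.card_fun, Fintype.card_prod, Fintype.card_coe, hI, Fintype.card_fin]
        rw [← sq, ← pow_mul, ← pow_mul]
        congr 1
        ring

end IDConverse

/-! ### Upper bound for transmission codes -/

section TransmissionConverse

variable {α : Type} [Fintype α] [DecidableEq α]

theorem IsCode.card_mul_le {n : ℕ} {l : ℝ} {M : ℕ}
    {ρ D : Fin M → Matrix (Fin n → α) (Fin n → α) ℂ}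
    (h : IsCode (idChannel α) n l M ρ D) : (M : ℝ) * (1 - l) ≤ (Fintype.card α : ℝ) ^ n := by
  calc (M : ℝ) * (1 - l) = ∑ _i : Fin M, (1 - l) := by
        rw [Finset.sum_const, Finset.card_univ, Fintype.card_fin, nsmul_eq_mul]
    _ ≤ ∑ i, (D i).trace.re := Finset.sum_le_sum fun i _ => (h.error i).trans <| by
        rw [prob_idChannel]
        exact (h.state i).trace_mul_re_le (h.povm.1 i)
    _ = (∑ i, D i).trace.re := by rw [Matrix.trace_sum, Complex.re_sum]
    _ = (Fintype.card α : ℝ) ^ n := by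
        rw [h.povm.2, Matrix.trace_one, Complex.natCast_re]
        simp

end TransmissionConverse

/-! ### The product basis as a code -/

section BasisCode

variable {α : Type} [Fintype α] [DecidableEq α]

theorem isState_single (a : α) : IsState (Matrix.single a a (1 : ℂ)) := by
  constructor
  · rw [← Matrix.diagonal_single, Matrix.posSemidef_diagonal_iff]
    intro b
    rw [Pi.single_apply]
    split_ifs <;> simp
  · simp

theorem isPOVM_single {ι : Type} [Fintype ι] (e : ι ≃ α) :
    IsPOVM fun i => Matrix.single (e i) (e i) (1 : ℂ) := by
  refine ⟨fun i => (isState_single (e i)).1, ?_⟩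
  rw [e.sum_comp (fun a => Matrix.single a a (1 : ℂ))]
  ext a b
  rw [Matrix.sum_apply, Matrix.one_apply]
  simp [Matrix.single_apply, ite_and]

theorem trace_single_mul_single_re (a b : α) :
    (Matrix.single a a (1 : ℂ) * Matrix.single b b 1).trace.re = if a = b then 1 else 0 := by
  split_ifs with h
  · subst h
    simp
  · simp [h]

/-- An enumeration of the product basis of `n` systems. -/
noncomputable def basisEquiv (α : Type) [Fintype α] [DecidableEq α] (n : ℕ) :
    Fin (Fintype.card α ^ n) ≃ (Fin n → α) :=
  (Fintype.equivFinOfCardEq (by simp)).symm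

theorem isCode_basis (n : ℕ) {l : ℝ} (hl : 0 ≤ l) :
    IsCode (idChannel α) n l (Fintype.card α ^ n)
      (fun i => Matrix.single (basisEquiv α n i) (basisEquiv α n i) 1)
      (fun i => Matrix.single (basisEquiv α n i) (basisEquiv α n i) 1) where
  state i := isState_single _
  povm := isPOVM_single (basisEquiv α n)
  error i := by
    rw [prob_idChannel, trace_single_mul_single_re, if_pos rfl]
    linarith

end BasisCode

/-! ### Projections of random sign vectors -/

section GaussianLinearization

open MeasureTheory

theorem neg_sq_add_mul_eq (a x : ℝ) :
    Real.exp (-x ^ 2 + a * x) = Real.exp (a ^ 2 / 4) * Real.exp (-1 * (x - a / 2) ^ 2) := by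
  rw [← Real.exp_add]
  congr 1
  ring

theorem integrable_exp_neg_sq_add_mul (a : ℝ) :
    Integrable fun x : ℝ => Real.exp (-x ^ 2 + a * x) := by
  simp_rw [neg_sq_add_mul_eq]
  exact ((integrable_exp_neg_mul_sq one_pos).comp_sub_right (a / 2)).const_mul _

theorem integral_exp_neg_sq_add_mul (a : ℝ) :
    ∫ x : ℝ, Real.exp (-x ^ 2 + a * x) = √Real.pi * Real.exp (a ^ 2 / 4) := by
  simp_rw [neg_sq_add_mul_eq]
  rw [integral_const_mul, integral_sub_right_eq_self (fun x : ℝ => Real.exp (-1 * x ^ 2)),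
    integral_gaussian, div_one, mul_comm]

/-- The sign of a fair coin. -/
def sgn (b : Bool) : ℝ := if b then 1 else -1

theorem sgn_sq (b : Bool) : sgn b ^ 2 = 1 := by
  cases b <;> simp [sgn]

variable {ι : Type} [Fintype ι]

theorem sum_mulVec_sq_of_orthonormal {m : ℕ} {E : Matrix ι (Fin m) ℝ} (hE : Eᵀ * E = 1)
    (g : Fin m → ℝ) : ∑ i, (E *ᵥ g) i ^ 2 = ∑ j, g j ^ 2 := by
  have h1 : (E *ᵥ g) ⬝ᵥ (E *ᵥ g) = g ⬝ᵥ g := by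
    rw [Matrix.dotProduct_mulVec, ← Matrix.mulVec_transpose, Matrix.mulVec_mulVec, hE,
      Matrix.one_mulVec]
  simpa [dotProduct, sq] using h1

variable [DecidableEq ι]

/-- A weighted sum of independent signs is subgaussian. -/
theorem sum_exp_signs_le (h : ι → ℝ) :
    ∑ ε : ι → Bool, Real.exp (∑ i, sgn (ε i) * h i) ≤
      2 ^ Fintype.card ι * Real.exp ((∑ i, h i ^ 2) / 2) := by
  have hprod : ∑ ε : ι → Bool, Real.exp (∑ i, sgn (ε i) * h i) =
      ∏ i, ∑ b : Bool, Real.exp (sgn b * h i) := by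
    rw [Finset.prod_univ_sum, Fintype.piFinset_univ]
    exact Finset.sum_congr rfl fun ε _ => Real.exp_sum _ _
  rw [hprod]
  calc ∏ i, ∑ b : Bool, Real.exp (sgn b * h i) ≤ ∏ i, (2 * Real.exp (h i ^ 2 / 2)) := by
        refine Finset.prod_le_prod (fun i _ => by positivity) fun i _ => ?_
        have h1 := Real.cosh_le_exp_half_sq (h i)
        rw [Real.cosh_eq] at h1
        simp only [Fintype.sum_bool, sgn, if_true, Bool.false_eq_true, if_false, one_mul, neg_mul]
        linarith
    _ = 2 ^ Fintype.card ι * Real.exp ((∑ i, h i ^ 2) / 2) := by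
        rw [Finset.prod_mul_distrib, Finset.prod_const, Finset.card_univ, ← Real.exp_sum,
          Finset.sum_div]

/-- The exponential moment of the squared length of the projection of a random sign vector to an
`m`-dimensional subspace. The identity `∫ exp (-x² + a x) dx = √π exp (a² / 4)`, used in each
coordinate of the subspace, makes the exponent linear in the signs, which can then be averaged
one by one. -/
theorem sum_exp_norm_sq_projection_le {m : ℕ} {E : Matrix ι (Fin m) ℝ} (hE : Eᵀ * E = 1) :
    ∑ ε : ι → Bool, Real.exp ((∑ j, (Eᵀ *ᵥ fun i => sgn (ε i)) j ^ 2) / 4) ≤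
      2 ^ Fintype.card ι * √2 ^ m := by
  set a : (ι → Bool) → Fin m → ℝ := fun ε => Eᵀ *ᵥ fun i => sgn (ε i) with ha
  have hpi : 0 < √Real.pi ^ m := by positivity
  have hone : ∀ ε, √Real.pi ^ m * Real.exp ((∑ j, a ε j ^ 2) / 4) =
      ∫ g : Fin m → ℝ, ∏ j, Real.exp (-g j ^ 2 + a ε j * g j) := by
    intro ε
    rw [integral_fintype_prod_volume_eq_prod (fun j x => Real.exp (-x ^ 2 + a ε j * x))]
    simp_rw [integral_exp_neg_sq_add_mul]
    rw [Finset.prod_mul_distrib, Finset.prod_const, Finset.card_univ, Fintype.card_fin,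
      ← Real.exp_sum, Finset.sum_div]
  have hint : ∀ ε ∈ (Finset.univ : Finset (ι → Bool)),
      Integrable fun g : Fin m → ℝ => ∏ j, Real.exp (-g j ^ 2 + a ε j * g j) := fun ε _ =>
    Integrable.fintype_prod (f := fun j x => Real.exp (-x ^ 2 + a ε j * x))
      fun j => integrable_exp_neg_sq_add_mul _
  have hint2 : Integrable fun g : Fin m → ℝ =>
      (2 : ℝ) ^ Fintype.card ι * ∏ j, Real.exp (-(1 / 2) * g j ^ 2) :=
    (Integrable.fintype_prod (f := fun _ x => Real.exp (-(1 / 2) * x ^ 2))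
      fun _ => integrable_exp_neg_mul_sq (by norm_num)).const_mul _
  have hpt : ∀ g : Fin m → ℝ, ∑ ε : ι → Bool, ∏ j, Real.exp (-g j ^ 2 + a ε j * g j) ≤
      2 ^ Fintype.card ι * ∏ j, Real.exp (-(1 / 2) * g j ^ 2) := by
    intro g
    have hexp : ∀ ε : ι → Bool, ∏ j, Real.exp (-g j ^ 2 + a ε j * g j) =
        Real.exp (-∑ j, g j ^ 2) * Real.exp (∑ i, sgn (ε i) * (E *ᵥ g) i) := by
      intro ε
      rw [← Real.exp_sum, ← Real.exp_add, Finset.sum_add_distrib, Finset.sum_neg_distrib]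
      congr 2
      change (Eᵀ *ᵥ fun i => sgn (ε i)) ⬝ᵥ g = (fun i => sgn (ε i)) ⬝ᵥ (E *ᵥ g)
      rw [Matrix.mulVec_transpose, Matrix.dotProduct_mulVec]
    simp_rw [hexp]
    rw [← Finset.mul_sum]
    calc Real.exp (-∑ j, g j ^ 2) * ∑ ε : ι → Bool, Real.exp (∑ i, sgn (ε i) * (E *ᵥ g) i)
        ≤ Real.exp (-∑ j, g j ^ 2) *
            (2 ^ Fintype.card ι * Real.exp ((∑ i, (E *ᵥ g) i ^ 2) / 2)) := by
          gcongr
          exact sum_exp_signs_le _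
      _ = 2 ^ Fintype.card ι * ∏ j, Real.exp (-(1 / 2) * g j ^ 2) := by
          rw [sum_mulVec_sq_of_orthonormal hE, ← Real.exp_sum, mul_left_comm, ← Real.exp_add,
            ← Finset.mul_sum]
          congr 2
          ring
  have htotal : √Real.pi ^ m * ∑ ε : ι → Bool, Real.exp ((∑ j, a ε j ^ 2) / 4) ≤
      √Real.pi ^ m * (2 ^ Fintype.card ι * √2 ^ m) := by
    rw [Finset.mul_sum]
    simp_rw [hone]
    rw [← integral_finsetSum _ hint]
    refine (integral_mono (integrable_finsetSum _ hint) hint2 hpt).trans (le_of_eq ?_)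
    rw [integral_const_mul,
      integral_fintype_prod_volume_eq_prod (fun (_ : Fin m) x => Real.exp (-(1 / 2) * x ^ 2))]
    simp_rw [integral_gaussian]
    rw [Finset.prod_const, Finset.card_univ, Fintype.card_fin,
      show Real.pi / (1 / 2) = Real.pi * 2 by ring, Real.sqrt_mul Real.pi_pos.le, mul_pow]
    ring
  exact le_of_mul_le_mul_left htotal hpi

end GaussianLinearization

section Concentration

theorem card_mul_exp_le_sum_exp {Ω : Type} [Fintype Ω] (f : Ω → ℝ) (t : ℝ) :
    ((Finset.univ.filter fun ω => t ≤ f ω).card : ℝ) * Real.exp (t / 4) ≤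
      ∑ ω, Real.exp (f ω / 4) := by
  rw [← nsmul_eq_mul]
  calc (Finset.univ.filter fun ω => t ≤ f ω).card • Real.exp (t / 4)
      ≤ ∑ ω with t ≤ f ω, Real.exp (f ω / 4) := by
        refine Finset.card_nsmul_le_sum _ _ _ fun ω hω => ?_
        have := (Finset.mem_filter.mp hω).2
        gcongr
    _ ≤ _ := Finset.sum_le_sum_of_subset_of_nonneg (Finset.filter_subset _ _)
        fun _ _ _ => (Real.exp_pos _).le

/-- The matrix whose columns are `r` sign vectors. -/
def signMatrix {ι : Type} {r : ℕ} (S : Fin r → ι → Bool) : Matrix ι (Fin r) ℝ :=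
  Matrix.of fun i k => sgn (S k i)

theorem sqrt_two_le_exp_half : √2 ≤ Real.exp (1 / 2) := by
  rw [Real.sqrt_le_left (Real.exp_pos _).le, ← Real.exp_nat_mul]
  have := Real.add_one_le_exp (1 : ℝ)
  norm_num at this ⊢
  linarith

variable {ι : Type} [Fintype ι] [DecidableEq ι]

/-- Few families of `r` sign vectors have a large total squared projection to a given subspace of
dimension at most `r` (Markov's inequality for the exponential moment). -/
theorem card_large_projection_le {m r : ℕ} (hm : m ≤ r) {E : Matrix ι (Fin m) ℝ}
    (hE : Eᵀ * E = 1) (t : ℝ) :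
    ((Finset.univ.filter fun S : Fin r → ι → Bool =>
        t ≤ ∑ k, ∑ j, (Eᵀ * signMatrix S) j k ^ 2).card : ℝ) ≤
      2 ^ (r * Fintype.card ι) * Real.exp ((r : ℝ) ^ 2 / 2 - t / 4) := by
  set F : (ι → Bool) → ℝ := fun ε => ∑ j, (Eᵀ *ᵥ fun i => sgn (ε i)) j ^ 2 with hF
  have hcol : ∀ S : Fin r → ι → Bool,
      ∑ k, ∑ j, (Eᵀ * signMatrix S) j k ^ 2 = ∑ k, F (S k) := fun S => rfl
  have hmoment : ∑ S : Fin r → ι → Bool, Real.exp ((∑ k, F (S k)) / 4) ≤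
      2 ^ (r * Fintype.card ι) * Real.exp ((r : ℝ) ^ 2 / 2) := by
    have hfac : ∑ S : Fin r → ι → Bool, Real.exp ((∑ k, F (S k)) / 4) =
        (∑ ε : ι → Bool, Real.exp (F ε / 4)) ^ r := by
      have hconst : (∑ ε : ι → Bool, Real.exp (F ε / 4)) ^ r =
          ∏ _k : Fin r, ∑ ε : ι → Bool, Real.exp (F ε / 4) := by simp
      rw [hconst, Finset.prod_univ_sum, Fintype.piFinset_univ]
      refine Finset.sum_congr rfl fun S _ => ?_
      rw [Finset.sum_div, Real.exp_sum]
    rw [hfac]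
    have h1 : ∑ ε : ι → Bool, Real.exp (F ε / 4) ≤
        2 ^ Fintype.card ι * Real.exp ((r : ℝ) / 2) := by
      refine (sum_exp_norm_sq_projection_le hE).trans ?_
      gcongr
      calc √2 ^ m ≤ √2 ^ r :=
            pow_le_pow_right₀ (Real.one_le_sqrt.mpr one_le_two) hm
        _ ≤ Real.exp (1 / 2) ^ r := by
            gcongr
            exact sqrt_two_le_exp_half
        _ = Real.exp ((r : ℝ) / 2) := by
            rw [← Real.exp_nat_mul]
            congr 1
            ring
    calc (∑ ε : ι → Bool, Real.exp (F ε / 4)) ^ r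
        ≤ (2 ^ Fintype.card ι * Real.exp ((r : ℝ) / 2)) ^ r := by gcongr
      _ = 2 ^ (r * Fintype.card ι) * Real.exp ((r : ℝ) ^ 2 / 2) := by
          rw [mul_pow, ← pow_mul, ← Real.exp_nat_mul, mul_comm r]
          congr 2
          ring
  simp only [hcol]
  rw [Real.exp_sub, ← mul_div_assoc, le_div_iff₀ (Real.exp_pos _)]
  exact (card_mul_exp_le_sum_exp (fun S : Fin r → ι → Bool => ∑ k, F (S k)) t).trans hmoment

end Concentration

/-! ### Independent sets in directed graphs -/

section IndependentSet

/-- In a finite directed graph all of whose out-degrees are at most `Δ`, some vertex has in-degree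
at most `Δ`. Choosing it and discarding its neighbours, again and again, gives a large set without
edges between distinct elements. -/
theorem exists_independent_finset {Ω : Type} [DecidableEq Ω] (bad : Ω → Ω → Prop)
    [DecidableRel bad] (Δ N : ℕ) (V : Finset Ω)
    (hout : ∀ v ∈ V, (V.filter (bad v)).card ≤ Δ) (hV : N * (2 * Δ + 1) ≤ V.card) :
    ∃ I ⊆ V, I.card = N ∧ ∀ v ∈ I, ∀ w ∈ I, v ≠ w → ¬ bad v w := by
  induction N generalizing V with
  | zero => exact ⟨∅, by simp, by simp, by simp⟩
  | succ N ih =>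
    have hne : V.Nonempty := by
      rw [← Finset.card_pos]
      nlinarith
    obtain ⟨v, hvV, hv⟩ : ∃ v ∈ V, (V.filter fun w => bad w v).card ≤ Δ := by
      have hsum : ∑ v ∈ V, (V.filter fun w => bad w v).card ≤ ∑ _v ∈ V, Δ := by
        refine le_trans (le_of_eq ?_) (Finset.sum_le_sum hout)
        simp only [Finset.card_filter]
        exact Finset.sum_comm
      exact Finset.exists_le_of_sum_le hne hsum
    set W := V.filter fun w => w ≠ v ∧ ¬ bad v w ∧ ¬ bad w v with hW
    have hsub : V ⊆ W ∪ ({v} ∪ (V.filter (bad v) ∪ V.filter fun w => bad w v)) := by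
      intro w hw
      simp only [hW, Finset.mem_union, Finset.mem_filter, Finset.mem_singleton, hw, true_and]
      tauto
    have hcard : V.card ≤ W.card + (1 + (Δ + Δ)) := by
      refine (Finset.card_le_card hsub).trans ((Finset.card_union_le _ _).trans ?_)
      refine Nat.add_le_add_left ((Finset.card_union_le _ _).trans ?_) _
      refine Nat.add_le_add (by simp) ((Finset.card_union_le _ _).trans ?_)
      exact Nat.add_le_add (hout v hvV) hv
    obtain ⟨I, hIW, hIc, hI⟩ := ih W
      (fun w hw => (Finset.card_le_card (Finset.filter_subset_filter _
        (Finset.filter_subset _ _))).trans (hout w (Finset.mem_filter.mp hw).1))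
      (by
        have : (N + 1) * (2 * Δ + 1) = N * (2 * Δ + 1) + (2 * Δ + 1) := by ring
        omega)
    have hIprop : ∀ w ∈ I, w ≠ v ∧ ¬ bad v w ∧ ¬ bad w v := fun w hw =>
      (Finset.mem_filter.mp (hIW hw)).2
    refine ⟨insert v I, ?_, ?_, ?_⟩
    · exact Finset.insert_subset hvV (hIW.trans (Finset.filter_subset _ _))
    · rw [Finset.card_insert_of_notMem fun h => (hIprop v h).1 rfl, hIc]
    · intro x hx y hy hxy
      rcases Finset.mem_insert.mp hx with rfl | hxI
      · rcases Finset.mem_insert.mp hy with rfl | hyI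
        · exact absurd rfl hxy
        · exact (hIprop y hyI).2.1
      · rcases Finset.mem_insert.mp hy with rfl | hyI
        · exact (hIprop x hxI).2.2
        · exact hI x hxI y hyI hxy

end IndependentSet

/-! ### Random ID codes -/

section RandomCode

variable {ι : Type} [Fintype ι]

/-- The complex positive semidefinite matrix `B Bᵀ` of a real matrix `B`. -/
def gram {κ : Type} [Fintype κ] (B : Matrix ι κ ℝ) : Matrix ι ι ℂ :=
  (B * Bᵀ).map Complex.ofReal

theorem trace_map_ofReal (A : Matrix ι ι ℝ) : (A.map Complex.ofReal).trace = (A.trace : ℂ) := by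
  simp [Matrix.trace]

theorem gram_mul_gram {κ κ' : Type} [Fintype κ] [Fintype κ'] (A : Matrix ι κ ℝ)
    (B : Matrix ι κ' ℝ) : gram A * gram B = (A * Aᵀ * (B * Bᵀ)).map Complex.ofReal := by
  rw [gram, gram]
  exact (Matrix.map_mul (f := Complex.ofRealHom)).symm

theorem posSemidef_gram {κ : Type} [Fintype κ] (B : Matrix ι κ ℝ) : (gram B).PosSemidef := by
  have h : gram B = (B.map Complex.ofReal) * (B.map Complex.ofReal)ᴴ := by
    ext a b
    simp [gram, Matrix.mul_apply]
  rw [h]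
  exact Matrix.posSemidef_self_mul_conjTranspose _

theorem trace_gram_mul_gram {κ κ' : Type} [Fintype κ] [Fintype κ'] (A : Matrix ι κ ℝ)
    (B : Matrix ι κ' ℝ) :
    (gram A * gram B).trace = ((∑ k, ∑ j, (Bᵀ * A) j k ^ 2 : ℝ) : ℂ) := by
  rw [gram_mul_gram, trace_map_ofReal]
  congr 1
  have h : (A * Aᵀ * (B * Bᵀ)).trace = ((Bᵀ * A)ᵀ * (Bᵀ * A)).trace := by
    rw [Matrix.transpose_mul, Matrix.transpose_transpose, Matrix.mul_assoc, Matrix.trace_mul_comm]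
    simp only [Matrix.mul_assoc]
  rw [h]
  simp only [Matrix.trace, Matrix.diag, Matrix.mul_apply (M := (Bᵀ * A)ᵀ), Matrix.transpose_apply,
    sq]

/-- The orthogonal projector onto the span of the columns of `A`, written as `E Eᵀ`. -/
theorem exists_orthonormal_columns {r : ℕ} (A : Matrix ι (Fin r) ℝ) :
    ∃ m ≤ r, ∃ E : Matrix ι (Fin m) ℝ, Eᵀ * E = 1 ∧ E * Eᵀ * A = A := by
  let v : Fin r → EuclideanSpace ℝ ι := fun k => WithLp.toLp 2 fun i => A i k
  let V := Submodule.span ℝ (Set.range v)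
  let b := stdOrthonormalBasis ℝ V
  refine ⟨Module.finrank ℝ V, ?_, Matrix.of fun i j => (b j : EuclideanSpace ℝ ι) i, ?_, ?_⟩
  · exact (finrank_range_le_card (R := ℝ) v).trans_eq (Fintype.card_fin r)
  · ext j j'
    have h := orthonormal_iff_ite.mp b.orthonormal j' j
    rw [Submodule.coe_inner, PiLp.inner_apply] at h
    rw [Matrix.mul_apply, Matrix.one_apply]
    simpa [eq_comm] using h
  · ext i k
    let w : V := ⟨v k, Submodule.subset_span ⟨k, rfl⟩⟩
    have h := congrArg (fun x : V => (x : EuclideanSpace ℝ ι) i) (b.sum_repr' w)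
    rw [Matrix.mul_assoc, Matrix.mul_apply]
    simp only [Submodule.coe_sum, Submodule.coe_smul, Submodule.coe_inner, PiLp.inner_apply,
      WithLp.ofLp_sum, WithLp.ofLp_smul, Finset.sum_apply, Pi.smul_apply, smul_eq_mul] at h
    refine Eq.trans (Finset.sum_congr rfl fun j _ => ?_) h
    rw [Matrix.mul_apply, mul_comm]
    congr 1
    refine Finset.sum_congr rfl fun x _ => ?_
    simp [w, v, mul_comm]

theorem trace_signMatrix_mul_transpose {r : ℕ} (S : Fin r → ι → Bool) :
    (signMatrix S * (signMatrix S)ᵀ).trace = r * Fintype.card ι := by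
  simp only [Matrix.trace, Matrix.diag, Matrix.mul_apply, Matrix.transpose_apply, signMatrix,
    Matrix.of_apply, ← sq, sgn_sq]
  simp [mul_comm]

/-- The normalized mixture of the `r` sign vectors in `S`. -/
noncomputable def signState {r : ℕ} (S : Fin r → ι → Bool) : Matrix ι ι ℂ :=
  ((r * Fintype.card ι : ℝ)⁻¹ : ℝ) • gram (signMatrix S)

theorem trace_signState_mul_gram_re {r m : ℕ} (S : Fin r → ι → Bool) (E : Matrix ι (Fin m) ℝ) :
    (signState S * gram E).trace.re =
      (r * Fintype.card ι : ℝ)⁻¹ * ∑ k, ∑ j, (Eᵀ * signMatrix S) j k ^ 2 := by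
  rw [signState, Matrix.smul_mul, Matrix.trace_smul, trace_gram_mul_gram, Complex.real_smul,
    ← Complex.ofReal_mul, Complex.ofReal_re]

theorem isState_signState [Nonempty ι] {r : ℕ} (hr : 0 < r) (S : Fin r → ι → Bool) :
    IsState (signState S) := by
  have hpos : (0 : ℝ) < r * Fintype.card ι := by
    have := Fintype.card_pos (α := ι)
    positivity
  constructor
  · have h : signState S =
        (((r * Fintype.card ι : ℝ)⁻¹ : ℝ) : ℂ) • gram (signMatrix S) := by
      ext a b
      simp [signState]
    rw [h]
    exact (posSemidef_gram _).smul (by exact_mod_cast (inv_pos.mpr hpos).le)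
  · rw [signState, Matrix.trace_smul, gram, trace_map_ofReal, trace_signMatrix_mul_transpose, Complex.real_smul,
      ← Complex.ofReal_mul, inv_mul_cancel₀ hpos.ne', Complex.ofReal_one]

theorem trace_signState_mul_gram_eq_one [Nonempty ι] {r m : ℕ} (hr : 0 < r)
    (S : Fin r → ι → Bool) {E : Matrix ι (Fin m) ℝ}
    (hES : E * Eᵀ * signMatrix S = signMatrix S) : (signState S * gram E).trace = 1 := by
  rw [← (isState_signState hr S).2, signState, Matrix.smul_mul, Matrix.trace_smul,
    Matrix.trace_smul, Matrix.trace_mul_comm, gram_mul_gram, ← Matrix.mul_assoc (E * Eᵀ), hES]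
  rfl

variable [DecidableEq ι]

theorem isEffect_gram {m : ℕ} {E : Matrix ι (Fin m) ℝ} (hE : Eᵀ * E = 1) :
    IsEffect (gram E) := by
  refine ⟨posSemidef_gram E, ?_⟩
  have hidem : gram E * gram E = gram E := by
    rw [gram_mul_gram, gram, Matrix.mul_assoc, ← Matrix.mul_assoc Eᵀ, hE, Matrix.one_mul]
  have hherm : (gram E)ᴴ = gram E := (posSemidef_gram E).1
  have h : 1 - gram E = (1 - gram E)ᴴ * (1 - gram E) := by
    rw [Matrix.conjTranspose_sub, Matrix.conjTranspose_one, hherm, Matrix.mul_sub, Matrix.sub_mul,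
      Matrix.sub_mul, hidem]
    simp
  rw [h]
  exact Matrix.posSemidef_conjTranspose_mul_self _

/-- Random mixtures of `r` sign vectors, together with the projectors onto the spans of the
vectors, form an ID code without errors of the first kind and with `exp (r d l / 8) / 3`
messages. -/
theorem exists_states_effects [Nonempty ι] {r N : ℕ} {l : ℝ} (hr : 0 < r) (hl1 : l ≤ 1)
    (hrl : (r : ℝ) ≤ Fintype.card ι * l / 4)
    (hN : 3 * (N : ℝ) ≤ Real.exp (r * Fintype.card ι * l / 8)) :
    ∃ ρ D : Fin N → Matrix ι ι ℂ, (∀ i, IsState (ρ i)) ∧ (∀ i, IsEffect (D i)) ∧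
      (∀ i, (ρ i * D i).trace.re = 1) ∧ ∀ i j, i ≠ j → (ρ i * D j).trace.re ≤ l := by
  classical
  choose m hm E hE hES using fun S : Fin r → ι → Bool => exists_orthonormal_columns (signMatrix S)
  set d : ℝ := (Fintype.card ι : ℝ) with hd
  have hd0 : 0 < d := by
    rw [hd]
    exact_mod_cast Fintype.card_pos (α := ι)
  have hr0 : (0 : ℝ) < r := by exact_mod_cast hr
  set Ω := Fin r → ι → Bool
  let bad : Ω → Ω → Prop := fun S T => l < (signState T * gram (E S)).trace.re
  have hΩ : ((Finset.univ : Finset Ω).card : ℝ) = 2 ^ (r * Fintype.card ι) := by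
    rw [Finset.card_univ, Fintype.card_fun, Fintype.card_fun, Fintype.card_bool, Fintype.card_fin,
      ← pow_mul, mul_comm r]
    push_cast
    rfl
  set q : ℝ := Real.exp (-(r * d * l / 8)) with hq
  have hout : ∀ S : Ω, ((Finset.univ.filter (bad S)).card : ℝ) ≤
      2 ^ (r * Fintype.card ι) * q := by
    intro S
    refine le_trans ?_ ((card_large_projection_le (hm S) (hE S) (r * d * l)).trans ?_)
    · refine Nat.cast_le.mpr (Finset.card_le_card fun T hT => ?_)
      have h : l < (signState T * gram (E S)).trace.re := (Finset.mem_filter.mp hT).2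
      rw [trace_signState_mul_gram_re, ← hd, lt_inv_mul_iff₀ (by positivity)] at h
      exact Finset.mem_filter.mpr ⟨Finset.mem_univ _, h.le⟩
    · rw [hq]
      gcongr
      nlinarith
  -- The cube of sign matrices is so large that a fraction `q` of it contains an element.
  have hone : 1 ≤ 2 ^ (r * Fintype.card ι) * q := by
    have h2 : (2 : ℝ) ^ (r * Fintype.card ι) = Real.exp (r * d * Real.log 2) := by
      rw [mul_comm _ (Real.log 2), Real.exp_mul, Real.exp_log two_pos, ← Real.rpow_natCast]
      push_cast
      rfl
    rw [h2, hq, ← Real.exp_add]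
    refine Real.one_le_exp ?_
    have hlog := Real.log_two_gt_d9
    have : r * d * l ≤ r * d * 1 := by gcongr
    have : r * d * (1 / 2) ≤ r * d * Real.log 2 := by
      gcongr
      linarith
    have : 0 < r * d := by positivity
    linarith
  set Δ := ⌊2 ^ (r * Fintype.card ι) * q⌋₊ with hΔ
  have hΔle : (Δ : ℝ) ≤ 2 ^ (r * Fintype.card ι) * q := Nat.floor_le (by positivity)
  obtain ⟨I, -, hIc, hI⟩ := exists_independent_finset bad Δ N Finset.univ
    (fun S _ => Nat.le_floor (hout S)) (by
      have h : (N : ℝ) * (2 * Δ + 1) ≤ ((Finset.univ : Finset Ω).card : ℝ) := by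
        calc (N : ℝ) * (2 * Δ + 1) ≤ N * (3 * (2 ^ (r * Fintype.card ι) * q)) := by
              gcongr
              linarith
          _ = 3 * N * (2 ^ (r * Fintype.card ι) * q) := by ring
          _ ≤ Real.exp (r * d * l / 8) * (2 ^ (r * Fintype.card ι) * q) := by gcongr
          _ = ((Finset.univ : Finset Ω).card : ℝ) := by
              rw [hΩ, mul_left_comm, hq, ← Real.exp_add, add_neg_cancel, Real.exp_zero, mul_one]
      exact_mod_cast h)
  let e := I.equivFinOfCardEq hIc
  refine ⟨fun i => signState (e.symm i : Ω), fun i => gram (E (e.symm i)),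
    fun i => isState_signState hr _, fun i => isEffect_gram (hE _), fun i => ?_,
    fun i j hij => not_lt.mp (hI _ (e.symm j).2 _ (e.symm i).2 fun h => hij ?_)⟩
  · rw [trace_signState_mul_gram_eq_one hr _ (hES _), Complex.one_re]
  · exact (e.symm.injective (Subtype.ext h)).symm

theorem exists_isIDCode {α : Type} [Fintype α] [DecidableEq α] [Nonempty α] {n r N : ℕ}
    {l₁ l₂ : ℝ} (hr : 0 < r) (hl₁ : 0 ≤ l₁) (hl₂ : l₂ ≤ 1)
    (hrl : (r : ℝ) ≤ (Fintype.card α : ℝ) ^ n * l₂ / 4)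
    (hN : 3 * (N : ℝ) ≤ Real.exp (r * (Fintype.card α : ℝ) ^ n * l₂ / 8)) :
    N ∈ idCodeSizes (idChannel α) n l₁ l₂ := by
  have hcard : (Fintype.card (Fin n → α) : ℝ) = (Fintype.card α : ℝ) ^ n := by simp
  rw [← hcard] at hrl hN
  obtain ⟨ρ, D, hρ, hD, h1, h2⟩ := exists_states_effects hr hl₂ hrl hN
  refine ⟨ρ, D, hρ, hD, fun i => ?_, fun i j hij => ?_⟩
  · rw [prob_idChannel, h1]
    linarith
  · rw [prob_idChannel]
    exact h2 i j hij

end RandomCode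

/-! ### Entropy of a guessed random variable -/

section Entropy

/-- Gibbs' inequality, for a subprobability vector `q` without zeros. -/
theorem entropy_le_cross_entropy {κ : Type} [Fintype κ] {p q : κ → ℝ} (hp : ∀ k, 0 ≤ p k)
    (hp1 : ∑ k, p k = 1) (hq : ∀ k, 0 < q k) (hq1 : ∑ k, q k ≤ 1) :
    -∑ k, p k * Real.logb 2 (p k) ≤ ∑ k, p k * -Real.logb 2 (q k) := by
  have hlog : 0 < Real.log 2 := Real.log_pos one_lt_two
  have hterm : ∀ k, p k * Real.log (q k) - p k * Real.log (p k) ≤ q k - p k := by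
    intro k
    rcases (hp k).eq_or_lt with h | h
    · simp [← h, (hq k).le]
    · have h1 := Real.log_le_sub_one_of_pos (div_pos (hq k) h)
      rw [Real.log_div (hq k).ne' h.ne'] at h1
      have h2 := mul_le_mul_of_nonneg_left h1 h.le
      rw [mul_sub, mul_sub, mul_div_cancel₀ _ h.ne', mul_one] at h2
      exact h2
  have hsum : ∑ k, p k * Real.log (q k) - ∑ k, p k * Real.log (p k) ≤ 0 := by
    rw [← Finset.sum_sub_distrib]
    refine (Finset.sum_le_sum fun k _ => hterm k).trans ?_
    rw [Finset.sum_sub_distrib, hp1]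
    linarith
  have hdiv : ∀ f : κ → ℝ, ∑ k, p k * Real.logb 2 (f k) =
      (∑ k, p k * Real.log (f k)) / Real.log 2 := by
    intro f
    rw [Finset.sum_div]
    exact Finset.sum_congr rfl fun k _ => by rw [Real.logb, mul_div_assoc]
  simp only [mul_neg, Finset.sum_neg_distrib]
  rw [hdiv p, hdiv q, neg_le_neg_iff, div_le_div_iff_of_pos_right hlog]
  linarith

/-- A Fano-type bound: a random variable that is guessed with success probabilities `t k` whose
sum is at most `2 ^ n` has little more than `n` bits of entropy. At most `2 * 2 ^ n` values have
`t k ≥ 1 / 2`. Gibbs' inequality is applied to half the uniform distribution on all values plus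
half the uniform one on those values, for which the code length `-log q k` is at most `n + 2`
at a well guessed value and at most `1 + log s` at any value. -/
theorem entropy_le_of_guessing {s n : ℕ} {p t : Fin s → ℝ} {ε : ℝ} (hp : ∀ k, 0 ≤ p k)
    (hp1 : ∑ k, p k = 1) (ht0 : ∀ k, 0 ≤ t k) (ht1 : ∀ k, t k ≤ 1)
    (ht : ∑ k, t k ≤ 2 ^ n) (hpt : 1 - ε ≤ ∑ k, p k * t k) :
    -∑ k, p k * Real.logb 2 (p k) ≤ n + 2 + 2 * ε * (1 + Real.logb 2 s) := by
  have hs : 0 < s := by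
    rcases Nat.eq_zero_or_pos s with rfl | h
    · simp at hp1
    · exact h
  have hs' : (1 : ℝ) ≤ s := by exact_mod_cast hs
  have hs0 : (0 : ℝ) < s := by exact_mod_cast hs
  have hlogs : 0 ≤ Real.logb 2 s := Real.logb_nonneg one_lt_two hs'
  let good : Finset (Fin s) := Finset.univ.filter fun k => 1 / 2 ≤ t k
  have hgood : (good.card : ℝ) ≤ 2 * 2 ^ n := by
    have h : good.card • (1 / 2 : ℝ) ≤ ∑ k ∈ good, t k :=
      Finset.card_nsmul_le_sum _ _ _ fun k hk => (Finset.mem_filter.mp hk).2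
    have h2 : ∑ k ∈ good, t k ≤ ∑ k, t k :=
      Finset.sum_le_sum_of_subset_of_nonneg (Finset.filter_subset _ _) fun k _ _ => ht0 k
    rw [nsmul_eq_mul] at h
    linarith
  let q : Fin s → ℝ := fun k => (if 1 / 2 ≤ t k then 1 / (4 * 2 ^ n) else 0) + 1 / (2 * s)
  have hite : ∀ k, 0 ≤ (if 1 / 2 ≤ t k then 1 / (4 * 2 ^ n) else (0 : ℝ)) := fun k => by
    split_ifs <;> positivity
  have hq : ∀ k, 0 < q k := fun k => add_pos_of_nonneg_of_pos (hite k) (by positivity)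
  have hq1 : ∑ k, q k ≤ 1 := by
    have h1 : ∑ k : Fin s, (if 1 / 2 ≤ t k then 1 / (4 * 2 ^ n) else (0 : ℝ)) ≤ 1 / 2 := by
      rw [← Finset.sum_filter, Finset.sum_const, nsmul_eq_mul, mul_one_div,
        div_le_iff₀ (by positivity)]
      change (good.card : ℝ) ≤ _
      linarith
    have h2 : ∑ _k : Fin s, 1 / (2 * (s : ℝ)) = 1 / 2 := by
      rw [Finset.sum_const, Finset.card_univ, Fintype.card_fin, nsmul_eq_mul]
      field_simp
    rw [Finset.sum_add_distrib, h2]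
    linarith
  have hlen : ∀ k, -Real.logb 2 (q k) ≤ n + 2 + 2 * (1 - t k) * (1 + Real.logb 2 s) := by
    intro k
    by_cases hk : 1 / 2 ≤ t k
    · have h1 : 1 / (4 * 2 ^ n) ≤ q k := by
        simp only [q, if_pos hk]
        have : (0 : ℝ) < 1 / (2 * s) := by positivity
        linarith
      have h2 := Real.logb_le_logb_of_le one_lt_two (by positivity) h1
      have h3 : Real.logb 2 (1 / (4 * 2 ^ n)) = -((n : ℝ) + 2) := by
        rw [one_div, Real.logb_inv, show (4 : ℝ) * 2 ^ n = 2 ^ (n + 2) by ring, Real.logb_pow,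
          Real.logb_self_eq_one one_lt_two]
        push_cast
        ring
      rw [h3] at h2
      have h4 : 0 ≤ 2 * (1 - t k) * (1 + Real.logb 2 s) :=
        mul_nonneg (by linarith [ht1 k]) (by linarith)
      linarith
    · have h1 : 1 / (2 * (s : ℝ)) ≤ q k := le_add_of_nonneg_left (hite k)
      have h2 := Real.logb_le_logb_of_le one_lt_two (by positivity) h1
      have h3 : Real.logb 2 (1 / (2 * (s : ℝ))) = -(1 + Real.logb 2 s) := by
        rw [one_div, Real.logb_inv, Real.logb_mul two_ne_zero hs0.ne',
          Real.logb_self_eq_one one_lt_two]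
      rw [h3] at h2
      have h4 : 1 * (1 + Real.logb 2 s) ≤ 2 * (1 - t k) * (1 + Real.logb 2 s) := by
        gcongr
        linarith
      have hn : (0 : ℝ) ≤ n := n.cast_nonneg
      linarith
  refine (entropy_le_cross_entropy hp hp1 hq hq1).trans ?_
  calc ∑ k, p k * -Real.logb 2 (q k)
      ≤ ∑ k, p k * (n + 2 + 2 * (1 - t k) * (1 + Real.logb 2 s)) :=
        Finset.sum_le_sum fun k _ => mul_le_mul_of_nonneg_left (hlen k) (hp k)
    _ = (∑ k, p k) * (n + 2) +
          2 * (∑ k, p k - ∑ k, p k * t k) * (1 + Real.logb 2 s) := by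
        rw [← Finset.sum_sub_distrib, Finset.sum_mul, Finset.mul_sum, Finset.sum_mul,
          ← Finset.sum_add_distrib]
        exact Finset.sum_congr rfl fun k _ => by ring
    _ ≤ n + 2 + 2 * ε * (1 + Real.logb 2 s) := by
        rw [hp1, one_mul]
        gcongr
        linarith

end Entropy

/-! ### Common randomness -/

namespace CRProtocol

theorem keyLaw_nonneg {n s : ℕ} (P : CRProtocol idQubit n s) (k : Fin s) : 0 ≤ P.keyLaw k :=
  Finset.sum_nonneg fun u _ => by
    split_ifs
    exacts [P.law_nonneg u, le_rfl]

theorem sum_keyLaw_mul {n s : ℕ} (P : CRProtocol idQubit n s) (f : Fin s → ℝ) :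
    ∑ k, P.keyLaw k * f k = ∑ u, P.law u * f (P.key u) := by
  simp only [keyLaw, Finset.sum_mul]
  rw [Finset.sum_comm]
  refine Finset.sum_congr rfl fun u _ => ?_
  simp

theorem sum_keyLaw {n s : ℕ} (P : CRProtocol idQubit n s) : ∑ k, P.keyLaw k = 1 := by
  simpa [P.law_sum] using P.sum_keyLaw_mul fun _ => 1

/-- Whatever state is sent, the receiver outputs `k` with probability at most the trace of the
sum of the operators of the outcomes that lead to `k`; these traces add up to the dimension. -/
theorem keyEntropy_le {n s : ℕ} (P : CRProtocol idQubit n s) {ε : ℝ}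
    (h : 1 - ε ≤ P.agreement) : P.keyEntropy ≤ n + 2 + 2 * ε * (1 + Real.logb 2 s) := by
  let w : Fin s → ℝ := fun k => ∑ v, if k = P.out v then (P.povm v).trace.re else 0
  have htr : ∀ v, 0 ≤ (P.povm v).trace.re := fun v =>
    (Complex.le_def.mp (P.isPOVM.1 v).trace_nonneg).1
  have hw0 : ∀ k, 0 ≤ w k := fun k => Finset.sum_nonneg fun v _ => by
    split_ifs
    exacts [htr v, le_rfl]
  have hwsum : ∑ k, w k = 2 ^ n := by
    simp only [w]
    rw [Finset.sum_comm]
    simp only [Finset.sum_ite_eq', Finset.mem_univ, if_true]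
    rw [← Complex.re_sum, ← Matrix.trace_sum, P.isPOVM.2, Matrix.trace_one, Complex.natCast_re]
    simp
  refine entropy_le_of_guessing (t := fun k => min 1 (w k)) P.keyLaw_nonneg P.sum_keyLaw
    (fun k => le_min zero_le_one (hw0 k)) (fun k => min_le_left _ _)
    ((Finset.sum_le_sum fun k _ => min_le_right _ _).trans hwsum.le) (h.trans ?_)
  rw [P.sum_keyLaw_mul]
  refine Finset.sum_le_sum fun u _ => ?_
  have hpr : ∀ v, prob idQubit n (P.state u) (P.povm v) =
      (P.state u * P.povm v).trace.re := fun v => prob_idChannel n _ _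
  have hpr0 : ∀ v, 0 ≤ (P.state u * P.povm v).trace.re := fun v =>
    trace_mul_re_nonneg (P.isState u).1 (P.isPOVM.1 v)
  calc ∑ v, (if P.key u = P.out v then P.law u * prob idQubit n (P.state u) (P.povm v) else 0)
      = P.law u * ∑ v, (if P.key u = P.out v then (P.state u * P.povm v).trace.re else 0) := by
        rw [Finset.mul_sum]
        refine Finset.sum_congr rfl fun v _ => ?_
        rw [hpr, mul_ite, mul_zero]
    _ ≤ P.law u * min 1 (w (P.key u)) := by
        refine mul_le_mul_of_nonneg_left (le_min ?_ ?_) (P.law_nonneg u)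
        · calc ∑ v, (if P.key u = P.out v then (P.state u * P.povm v).trace.re else 0)
              ≤ ∑ v, (P.state u * P.povm v).trace.re := Finset.sum_le_sum fun v _ => by
                split_ifs
                exacts [le_rfl, hpr0 v]
            _ = 1 := by
                rw [← Complex.re_sum, ← Matrix.trace_sum, ← Matrix.mul_sum, P.isPOVM.2,
                  Matrix.mul_one, (P.isState u).trace_re_eq_one]
        · refine Finset.sum_le_sum fun v _ => ?_
          split_ifs
          exacts [(P.isState u).trace_mul_re_le (P.isPOVM.1 v), le_rfl]

/-- The protocol that sends a uniformly random element of the product basis. -/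
noncomputable def uniform (n : ℕ) : CRProtocol idQubit n (Fintype.card (Fin 2) ^ n) where
  U := Fintype.card (Fin 2) ^ n
  law _ := ((2 : ℝ) ^ n)⁻¹
  law_nonneg _ := by positivity
  law_sum := by simp
  state u := Matrix.single (basisEquiv (Fin 2) n u) (basisEquiv (Fin 2) n u) 1
  isState u := isState_single _
  key := id
  V := Fintype.card (Fin 2) ^ n
  povm v := Matrix.single (basisEquiv (Fin 2) n v) (basisEquiv (Fin 2) n v) 1
  isPOVM := isPOVM_single (basisEquiv (Fin 2) n)
  out := id

theorem uniform_agreement (n : ℕ) : (uniform n).agreement = 1 := by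
  rw [← (uniform n).law_sum, agreement]
  refine Finset.sum_congr rfl fun (u : Fin (Fintype.card (Fin 2) ^ n)) _ => ?_
  change ∑ v : Fin (Fintype.card (Fin 2) ^ n), (if u = v then ((2 : ℝ) ^ n)⁻¹ *
    prob idQubit n (Matrix.single (basisEquiv (Fin 2) n u) (basisEquiv (Fin 2) n u) 1)
      (Matrix.single (basisEquiv (Fin 2) n v) (basisEquiv (Fin 2) n v) 1) else 0) =
    ((2 : ℝ) ^ n)⁻¹
  rw [Finset.sum_ite_eq, if_pos (Finset.mem_univ u), prob_idChannel,
    trace_single_mul_single_re, if_pos rfl, mul_one]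

theorem uniform_keyEntropy (n : ℕ) : (uniform n).keyEntropy = n := by
  have hlaw : ∀ k, (uniform n).keyLaw k = ((2 : ℝ) ^ n)⁻¹ := fun k => by
    change ∑ u : Fin (Fintype.card (Fin 2) ^ n), (if u = k then ((2 : ℝ) ^ n)⁻¹ else 0) = _
    rw [Finset.sum_ite_eq', if_pos (Finset.mem_univ k)]
  rw [keyEntropy]
  simp only [hlaw]
  rw [Finset.sum_const, Finset.card_univ, Fintype.card_fin, nsmul_eq_mul, Real.logb_inv,
    Real.logb_pow, Real.logb_self_eq_one one_lt_two]
  simp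

end CRProtocol

theorem isAchievableCRRate_one : IsAchievableCRRate idQubit 1 := by
  refine ⟨1, fun ε hε => ?_⟩
  filter_upwards [eventually_ge_atTop 1] with n hn
  refine ⟨_, CRProtocol.uniform n, ?_, ?_, ?_⟩
  · simp
  · rw [CRProtocol.uniform_agreement]
    linarith
  · have : (n : ℝ) ≠ 0 := by positivity
    rw [CRProtocol.uniform_keyEntropy, one_div_mul_cancel this]
    linarith

theorem IsAchievableCRRate.le_one {R : ℝ} (h : IsAchievableCRRate idQubit R) : R ≤ 1 := by
  obtain ⟨c, hc⟩ := h
  have hε : ∀ ε : ℝ, 0 < ε → R ≤ 1 + ε * (1 + 2 * c) := by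
    intro ε hε
    have hlim : Tendsto (fun n : ℕ => ε + (1 + 2 * ε * c + (2 + 2 * ε) * (1 / (n : ℝ)))) atTop
        (𝓝 (ε + (1 + 2 * ε * c + (2 + 2 * ε) * 0))) :=
      ((tendsto_one_div_atTop_nhds_zero_nat.const_mul _).const_add _).const_add _
    rw [show 1 + ε * (1 + 2 * c) = ε + (1 + 2 * ε * c + (2 + 2 * ε) * 0) by ring]
    refine ge_of_tendsto hlim ?_
    filter_upwards [hc ε hε, eventually_ge_atTop 1] with n hn hn1
    obtain ⟨s, P, hs, hagree, hR⟩ := hn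
    have hn0 : (0 : ℝ) < n := by exact_mod_cast hn1
    have hs0 : (0 : ℝ) < s := by
      rcases Nat.eq_zero_or_pos s with rfl | h
      · simpa using P.sum_keyLaw
      · exact_mod_cast h
    have hlog : Real.logb 2 s ≤ c * n := by
      rwa [Real.logb_le_iff_le_rpow one_lt_two hs0]
    have hH : P.keyEntropy ≤ n + 2 + 2 * ε * (1 + c * n) :=
      (P.keyEntropy_le hagree).trans (by gcongr)
    have h2 : 1 / (n : ℝ) * P.keyEntropy ≤ 1 / n * (n + 2 + 2 * ε * (1 + c * n)) := by gcongr
    have h3 : 1 / (n : ℝ) * (n + 2 + 2 * ε * (1 + c * n)) =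
        1 + 2 * ε * c + (2 + 2 * ε) * (1 / (n : ℝ)) := by
      field_simp
      ring
    linarith
  have hlim : Tendsto (fun ε : ℝ => 1 + ε * (1 + 2 * c)) (𝓝[>] 0) (𝓝 (1 + 0 * (1 + 2 * c))) :=
    tendsto_nhdsWithin_of_tendsto_nhds ((by fun_prop : Continuous fun ε : ℝ =>
      1 + ε * (1 + 2 * c)).tendsto 0)
  rw [zero_mul, add_zero] at hlim
  exact ge_of_tendsto hlim (eventually_mem_nhdsWithin.mono fun ε h => hε ε h)

theorem crCapacity_idQubit : crCapacity idQubit = 1 := by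
  refine le_antisymm (iSup₂_le fun R hR => ?_) ?_
  · exact_mod_cast hR.le_one
  · exact le_iSup₂_of_le (1 : ℝ) isAchievableCRRate_one (by simp)

/-! ### Existence of the maxima -/

section Maxima

theorem isGreatest_codeSizes {l : ℝ} (h0 : 0 ≤ l) (h1 : l < 1) (n : ℕ) :
    IsGreatest (codeSizes idQubit n l) (maxCode idQubit n l) := by
  have hbdd : BddAbove (codeSizes idQubit n l) := by
    refine ⟨⌊(2 : ℝ) ^ n / (1 - l)⌋₊, ?_⟩
    rintro M ⟨ρ, D, h⟩
    refine Nat.le_floor ?_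
    rw [le_div_iff₀ (by linarith)]
    simpa using h.card_mul_le
  exact ⟨Nat.sSup_mem ⟨_, _, _, isCode_basis n h0⟩ hbdd, fun M hM => le_csSup hbdd hM⟩

theorem idCode_card_le {l₁ l₂ : ℝ} {C : ℕ} (hC : 2 < C * (1 - l₁ - l₂)) {n N : ℕ}
    (hN : N ∈ idCodeSizes idQubit n l₁ l₂) :
    N ≤ (2 * (C * 4 ^ n) + 1) ^ (2 * 4 ^ n) := by
  obtain ⟨ρ, D, h⟩ := hN
  have hC0 : 0 < C := by
    rcases Nat.eq_zero_or_pos C with rfl | h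
    · norm_num at hC
    · exact h
  have h4 : ((2 : ℝ) ^ n) ^ 2 = 4 ^ n := by
    rw [← pow_mul, mul_comm, pow_mul]
    norm_num
  have h4' : (2 ^ n) ^ 2 = 4 ^ n := by
    rw [← pow_mul, mul_comm, pow_mul]
    norm_num
  have h4pos : (0 : ℝ) < 4 ^ n := by positivity
  have := h.card_le (K := C * 4 ^ n) (by positivity) (by
    rw [Fintype.card_fin]
    push_cast
    rw [h4]
    nlinarith)
  rwa [Fintype.card_fin, h4'] at this

theorem isGreatest_idCodeSizes {l₁ l₂ : ℝ} (h : l₁ + l₂ < 1) (n : ℕ) :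
    IsGreatest (idCodeSizes idQubit n l₁ l₂) (maxID idQubit n l₁ l₂) := by
  obtain ⟨C, hC⟩ := exists_nat_gt (2 / (1 - l₁ - l₂))
  rw [div_lt_iff₀ (by linarith)] at hC
  have hbdd : BddAbove (idCodeSizes idQubit n l₁ l₂) := ⟨_, fun N hN => idCode_card_le hC hN⟩
  refine ⟨Nat.sSup_mem ⟨0, fun _ => 0, fun _ => 0, ?_⟩ hbdd, fun N hN => le_csSup hbdd hN⟩
  exact ⟨fun i => i.elim0, fun i => i.elim0, fun i => i.elim0, fun i => i.elim0⟩

end Maxima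

/-! ### Rates and capacities -/

section Rates

theorem tendsto_codeRate {l : ℝ} (h0 : 0 ≤ l) (h1 : l < 1) :
    Tendsto (codeRate idQubit l) atTop (𝓝 1) := by
  have hupper : Tendsto (fun n : ℕ => 1 + -Real.logb 2 (1 - l) * (1 / (n : ℝ))) atTop
      (𝓝 (1 + -Real.logb 2 (1 - l) * 0)) :=
    (tendsto_one_div_atTop_nhds_zero_nat.const_mul _).const_add _
  rw [mul_zero, add_zero] at hupper
  have hlog : ∀ n : ℕ, Real.logb 2 ((2 : ℝ) ^ n) = n := fun n => by
    rw [Real.logb_pow, Real.logb_self_eq_one one_lt_two, mul_one]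
  have hbounds : ∀ n : ℕ, (2 : ℝ) ^ n ≤ maxCode idQubit n l ∧
      (maxCode idQubit n l : ℝ) ≤ 2 ^ n / (1 - l) := by
    intro n
    have hmax := isGreatest_codeSizes h0 h1 n
    constructor
    · have := hmax.2 ⟨_, _, isCode_basis n h0⟩
      rw [Fintype.card_fin] at this
      exact_mod_cast this
    · obtain ⟨ρ, D, h⟩ := hmax.1
      rw [le_div_iff₀ (by linarith)]
      simpa using h.card_mul_le
  refine tendsto_of_tendsto_of_tendsto_of_le_of_le' tendsto_const_nhds hupper ?_ ?_
  · filter_upwards [eventually_ge_atTop 1] with n hn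
    have hn0 : (0 : ℝ) < n := by exact_mod_cast hn
    have h := Real.logb_le_logb_of_le one_lt_two (by positivity) (hbounds n).1
    rw [hlog] at h
    rw [codeRate, one_div_mul_eq_div, le_div_iff₀ hn0, one_mul]
    exact h
  · filter_upwards [eventually_ge_atTop 1] with n hn
    have hn0 : (0 : ℝ) < n := by exact_mod_cast hn
    have hpos : (0 : ℝ) < maxCode idQubit n l := lt_of_lt_of_le (by positivity) (hbounds n).1
    have h := Real.logb_le_logb_of_le one_lt_two hpos (hbounds n).2
    rw [Real.logb_div (by positivity) (by linarith), hlog] at h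
    rw [codeRate, one_div_mul_eq_div, div_le_iff₀ hn0, add_mul, mul_assoc,
      one_div_mul_cancel hn0.ne', one_mul, mul_one]
    linarith

theorem exp_half_le {y : ℝ} (hy : 6 ≤ y) : Real.exp (y / 2) ≤ Real.exp y / 3 - 1 := by
  have h1 : Real.exp y = Real.exp (y / 2) * Real.exp (y / 2) := by
    rw [← Real.exp_add, add_halves]
  have h2 : 4 ≤ Real.exp (y / 2) := by
    have := Real.add_one_le_exp (y / 2)
    linarith
  rw [h1]
  nlinarith

/-- Random codes built from `r = ⌊2 ^ n * l₂ / 4⌋` sign vectors per message have at least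
`exp (c 4 ^ n)` messages. -/
theorem eventually_le_logb_maxID {l₁ l₂ : ℝ} (hl₁ : 0 < l₁) (hl₂ : 0 < l₂) (h : l₁ + l₂ < 1) :
    ∀ᶠ n : ℕ in atTop, l₂ ^ 2 / 128 * 4 ^ n ≤ Real.logb 2 (maxID idQubit n l₁ l₂) := by
  have hlarge1 : ∀ᶠ n : ℕ in atTop, 4 / l₂ ≤ (2 : ℝ) ^ n :=
    (tendsto_pow_atTop_atTop_of_one_lt one_lt_two).eventually_ge_atTop _
  have hlarge2 : ∀ᶠ n : ℕ in atTop, 6 * 64 / l₂ ^ 2 ≤ (4 : ℝ) ^ n :=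
    (tendsto_pow_atTop_atTop_of_one_lt (by norm_num)).eventually_ge_atTop _
  filter_upwards [hlarge1, hlarge2] with n hn1 hn2
  rw [div_le_iff₀ hl₂] at hn1
  rw [div_le_iff₀ (by positivity)] at hn2
  set r := ⌊(2 : ℝ) ^ n * l₂ / 4⌋₊ with hr
  have hrle : (r : ℝ) ≤ 2 ^ n * l₂ / 4 := Nat.floor_le (by positivity)
  have hr1 : 1 ≤ r := Nat.le_floor (by
    push_cast
    linarith)
  have hrge : (2 : ℝ) ^ n * l₂ / 8 ≤ r := by
    have h1 : (2 : ℝ) ^ n * l₂ / 4 < r + 1 := Nat.lt_floor_add_one _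
    have h2 : (1 : ℝ) ≤ r := by exact_mod_cast hr1
    linarith
  set y : ℝ := 4 ^ n * l₂ ^ 2 / 64 with hy
  have hy6 : 6 ≤ y := by
    rw [hy]
    linarith
  have h4 : (2 : ℝ) ^ n * 2 ^ n = 4 ^ n := by
    rw [← mul_pow]
    norm_num
  have hexp : Real.exp y ≤ Real.exp (r * (2 : ℝ) ^ n * l₂ / 8) := by
    refine Real.exp_le_exp.mpr ?_
    calc y = ((2 : ℝ) ^ n * l₂ / 8) * (2 ^ n * l₂ / 8) := by
          rw [hy, ← h4]
          ring
      _ ≤ r * (2 ^ n * l₂ / 8) := by gcongr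
      _ = r * (2 : ℝ) ^ n * l₂ / 8 := by ring
  set N := ⌊Real.exp y / 3⌋₊ with hNdef
  have hN3 : (N : ℝ) ≤ Real.exp y / 3 := Nat.floor_le (by positivity)
  have hNmem : N ∈ idCodeSizes idQubit n l₁ l₂ := by
    refine exists_isIDCode (r := r) hr1 hl₁.le (by linarith) ?_ ?_
    · rw [Fintype.card_fin]
      exact_mod_cast hrle
    · rw [Fintype.card_fin]
      push_cast
      linarith
  have hmax : (N : ℝ) ≤ maxID idQubit n l₁ l₂ := by
    exact_mod_cast (isGreatest_idCodeSizes h n).2 hNmem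
  have hlow : Real.exp (y / 2) ≤ maxID idQubit n l₁ l₂ := by
    have h1 : Real.exp y / 3 < N + 1 := Nat.lt_floor_add_one _
    have h2 := exp_half_le hy6
    linarith
  have hlog := Real.log_le_log (Real.exp_pos _) hlow
  rw [Real.log_exp] at hlog
  have hlog2 : Real.log 2 ≤ 1 := by
    have := Real.log_two_lt_d9
    linarith
  rw [Real.logb, le_div_iff₀ (Real.log_pos one_lt_two)]
  calc l₂ ^ 2 / 128 * 4 ^ n * Real.log 2 ≤ l₂ ^ 2 / 128 * 4 ^ n * 1 := by gcongr
    _ = y / 2 := by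
        rw [hy]
        ring
    _ ≤ _ := hlog

theorem exists_logb_maxID_le {l₁ l₂ : ℝ} (h : l₁ + l₂ < 1) :
    ∃ A : ℝ, 0 < A ∧ ∀ n : ℕ, 1 ≤ n → Real.logb 2 (maxID idQubit n l₁ l₂) ≤ A * n * 4 ^ n := by
  obtain ⟨C, hC⟩ := exists_nat_gt (2 / (1 - l₁ - l₂))
  rw [div_lt_iff₀ (by linarith)] at hC
  have hC0 : 0 < C := by
    rcases Nat.eq_zero_or_pos C with rfl | h
    · norm_num at hC
    · exact h
  have hC1 : (1 : ℝ) ≤ C := by exact_mod_cast hC0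
  have hlogC : 0 ≤ Real.logb 2 (3 * C) := Real.logb_nonneg one_lt_two (by linarith)
  refine ⟨2 * (Real.logb 2 (3 * C) + 2), by positivity, fun n hn => ?_⟩
  have hn1 : (1 : ℝ) ≤ n := by exact_mod_cast hn
  have h4 : (1 : ℝ) ≤ 4 ^ n := one_le_pow₀ (by norm_num)
  rcases Nat.eq_zero_or_pos (maxID idQubit n l₁ l₂) with h0 | hpos
  · rw [h0, Nat.cast_zero, Real.logb_zero]
    positivity
  have hle : (maxID idQubit n l₁ l₂ : ℝ) ≤ (3 * C * 4 ^ n) ^ (2 * 4 ^ n) := by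
    have h1 : (maxID idQubit n l₁ l₂ : ℝ) ≤ (2 * (C * 4 ^ n) + 1) ^ (2 * 4 ^ n) := by
      exact_mod_cast idCode_card_le hC (isGreatest_idCodeSizes h n).1
    refine h1.trans (pow_le_pow_left₀ (by positivity) ?_ _)
    nlinarith
  have hlog := Real.logb_le_logb_of_le one_lt_two (by exact_mod_cast hpos) hle
  have hlog4 : Real.logb 2 4 = 2 := by
    rw [show (4 : ℝ) = 2 ^ 2 by norm_num, Real.logb_pow, Real.logb_self_eq_one one_lt_two]
    norm_num
  rw [Real.logb_pow, Real.logb_mul (by positivity) (by positivity), Real.logb_pow, hlog4] at hlog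
  push_cast at hlog
  refine hlog.trans ?_
  have : Real.logb 2 (3 * C) + n * 2 ≤ (Real.logb 2 (3 * C) + 2) * n := by nlinarith
  calc 2 * 4 ^ n * (Real.logb 2 (3 * C) + n * 2)
      ≤ 2 * 4 ^ n * ((Real.logb 2 (3 * C) + 2) * n) := by gcongr
    _ = _ := by ring

theorem tendsto_idRate {l₁ l₂ : ℝ} (hl₁ : 0 < l₁) (hl₂ : 0 < l₂) (h : l₁ + l₂ < 1) :
    Tendsto (idRate idQubit l₁ l₂) atTop (𝓝 2) := by
  obtain ⟨A, hA, hupper⟩ := exists_logb_maxID_le h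
  have hlog4 : ∀ n : ℕ, Real.logb 2 ((4 : ℝ) ^ n) = 2 * n := fun n => by
    rw [show (4 : ℝ) = 2 ^ 2 by norm_num, ← pow_mul, Real.logb_pow,
      Real.logb_self_eq_one one_lt_two]
    push_cast
    ring
  have hinv := tendsto_one_div_atTop_nhds_zero_nat (𝕜 := ℝ)
  have hlogn : Tendsto (fun n : ℕ => Real.logb 2 n / n) atTop (𝓝 0) := by
    have h1 : Tendsto (fun x : ℝ => Real.log x / x) atTop (𝓝 0) :=
      Real.isLittleO_log_id_atTop.tendsto_div_nhds_zero
    have h2 := (h1.comp tendsto_natCast_atTop_atTop).div_const (Real.log 2)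
    rw [zero_div] at h2
    refine h2.congr fun n => ?_
    simp only [Function.comp, Real.logb]
    ring
  have hlo : Tendsto (fun n : ℕ => 2 + Real.logb 2 (l₂ ^ 2 / 128) * (1 / (n : ℝ))) atTop
      (𝓝 (2 + Real.logb 2 (l₂ ^ 2 / 128) * 0)) := (hinv.const_mul _).const_add _
  have hhi : Tendsto (fun n : ℕ => 2 + (Real.logb 2 A * (1 / (n : ℝ)) + Real.logb 2 n / n)) atTop
      (𝓝 (2 + (Real.logb 2 A * 0 + 0))) := ((hinv.const_mul _).add hlogn).const_add _
  rw [mul_zero, add_zero] at hlo hhi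
  rw [add_zero] at hhi
  refine tendsto_of_tendsto_of_tendsto_of_le_of_le' hlo hhi ?_ ?_
  · filter_upwards [eventually_ge_atTop 1, eventually_le_logb_maxID hl₁ hl₂ h] with n hn hlow
    have hn0 : (0 : ℝ) < n := by exact_mod_cast hn
    have h1 := Real.logb_le_logb_of_le one_lt_two (by positivity) hlow
    rw [Real.logb_mul (by positivity) (by positivity), hlog4] at h1
    rw [idRate, one_div_mul_eq_div, le_div_iff₀ hn0, add_mul, mul_assoc,
      one_div_mul_cancel hn0.ne']
    linarith
  · filter_upwards [eventually_ge_atTop 1, eventually_le_logb_maxID hl₁ hl₂ h] with n hn hlow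
    have hn0 : (0 : ℝ) < n := by exact_mod_cast hn
    have hpos : 0 < Real.logb 2 (maxID idQubit n l₁ l₂) := lt_of_lt_of_le (by positivity) hlow
    have h1 := Real.logb_le_logb_of_le one_lt_two hpos (hupper n hn)
    rw [Real.logb_mul (by positivity) (by positivity), Real.logb_mul hA.ne' hn0.ne', hlog4] at h1
    rw [idRate, one_div_mul_eq_div, div_le_iff₀ hn0, add_mul, add_mul, mul_assoc (Real.logb 2 A),
      one_div_mul_cancel hn0.ne', div_mul_cancel₀ _ hn0.ne']
    linarith

theorem idCapacity_idQubit : idCapacity idQubit = 2 := by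
  have hlim : ∀ l₁ l₂ : ℝ, 0 < l₁ ∧ 0 < l₂ ∧ l₁ + l₂ < 1 →
      liminf (fun n : ℕ => (idRate idQubit l₁ l₂ n : EReal)) atTop = 2 := fun l₁ l₂ h =>
    ((continuous_coe_real_ereal.tendsto _).comp (tendsto_idRate h.1 h.2.1 h.2.2)).liminf_eq
  refine le_antisymm ?_ (le_iInf fun l₁ => le_iInf fun l₂ => le_iInf fun h => (hlim l₁ l₂ h).ge)
  have hmem : (0 : ℝ) < 1 / 4 ∧ (0 : ℝ) < 1 / 4 ∧ (1 / 4 : ℝ) + 1 / 4 < 1 := by norm_num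
  exact iInf_le_of_le (1 / 4) (iInf₂_le_of_le (1 / 4) hmem (hlim _ _ hmem).le)

theorem transmissionCapacity_idQubit : transmissionCapacity idQubit = 1 := by
  have hlim : ∀ l : ℝ, 0 < l ∧ l < 1 →
      liminf (fun n : ℕ => (codeRate idQubit l n : EReal)) atTop = 1 := fun l h =>
    ((continuous_coe_real_ereal.tendsto _).comp (tendsto_codeRate h.1.le h.2)).liminf_eq
  refine le_antisymm ?_ (le_iInf₂ fun l h => (hlim l h).ge)
  have hmem : (0 : ℝ) < 1 / 2 ∧ (1 / 2 : ℝ) < 1 := by norm_num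
  exact iInf₂_le_of_le (1 / 2) hmem (hlim _ hmem).le

theorem transmissionCapacityUpper_idQubit : transmissionCapacityUpper idQubit = 1 := by
  have hlim : ∀ l : ℝ, 0 < l ∧ l < 1 →
      limsup (fun n : ℕ => (codeRate idQubit l n : EReal)) atTop = 1 := fun l h =>
    ((continuous_coe_real_ereal.tendsto _).comp (tendsto_codeRate h.1.le h.2)).limsup_eq
  refine le_antisymm ?_ (le_iInf₂ fun l h => (hlim l h).ge)
  have hmem : (0 : ℝ) < 1 / 2 ∧ (1 / 2 : ℝ) < 1 := by norm_num
  exact iInf₂_le_of_le (1 / 2) hmem (hlim _ hmem).le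

end Rates

end QuantumID

theorem mainTheorem1 :
    (∀ l₁ l₂ : ℝ, 0 < l₁ → 0 < l₂ → l₁ + l₂ < 1 →
      (∀ n : ℕ, IsGreatest (QuantumID.idCodeSizes QuantumID.idQubit n l₁ l₂)
        (QuantumID.maxID QuantumID.idQubit n l₁ l₂)) ∧
      Tendsto (fun n : ℕ => 1 / (n : ℝ) *
          Real.logb 2 (Real.logb 2 (QuantumID.maxID QuantumID.idQubit n l₁ l₂ : ℝ)))
        atTop (𝓝 2)) ∧
    QuantumID.idCapacity QuantumID.idQubit = 2 ∧
    (∀ l : ℝ, 0 < l → l < 1 → ∀ n : ℕ,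
      IsGreatest (QuantumID.codeSizes QuantumID.idQubit n l)
        (QuantumID.maxCode QuantumID.idQubit n l)) ∧
    QuantumID.transmissionCapacity QuantumID.idQubit = 1 ∧
    QuantumID.transmissionCapacityUpper QuantumID.idQubit = 1 ∧
    QuantumID.crCapacity QuantumID.idQubit = 1 ∧
    QuantumID.idCapacity QuantumID.idQubit =
      2 * QuantumID.transmissionCapacity QuantumID.idQubit ∧
    QuantumID.idCapacity QuantumID.idQubit =
      2 * QuantumID.crCapacity QuantumID.idQubit := by
  refine ⟨fun l₁ l₂ hl₁ hl₂ h => ⟨fun n => QuantumID.isGreatest_idCodeSizes h n,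
      QuantumID.tendsto_idRate hl₁ hl₂ h⟩, QuantumID.idCapacity_idQubit,
    fun l h0 h1 n => QuantumID.isGreatest_codeSizes h0.le h1 n,
    QuantumID.transmissionCapacity_idQubit, QuantumID.transmissionCapacityUpper_idQubit,
    QuantumID.crCapacity_idQubit, ?_, ?_⟩
  · rw [QuantumID.idCapacity_idQubit, QuantumID.transmissionCapacity_idQubit, mul_one]
  · rw [QuantumID.idCapacity_idQubit, QuantumID.crCapacity_idQubit, mul_one]
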